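/- **Setting.** Let $d\ge 1$ and let $R\subset\mathbb R^d$ be a normalized root system, i.e. a finite set of unit vectors with $\sigma_\alpha(R)=R$ for all $\alpha\in R$, where $\sigma_\alpha(x)=x-2\langle\alpha,x\rangle\alpha$. Let $W\subset O(\mathbb R^d)$ be the (finite) group generated by $\{\sigma_\alpha:\alpha\in R\}$. Fix $\check\alpha\in\mathbb R^d$ with $\langle\alpha,\check\alpha\rangle\ne0$ for all $\alpha\in R$, and put $R_+=\{\alpha\in R:\langle\alpha,\check\alpha\rangle>0\}$ and $C_+=\{x\in\mathbb R^d:\langle x,\alpha\rangle>0\ \text{for all}\ \alpha\in R_+\}$. Let $\Omega\subset\mathbb R^d$ be open with $\sigma_\alpha(\Omega)=\Omega$ for all $\alpha\in R$, and let $\Omega_+=\Omega\cap C_+$. For a function $F$ on $\Omega$ write $F^+=F|_{\Omega_+}$, and for $\omega\colon W\to\mathbb C$ put $$\mathcal A_\omega F(y)=\frac1{|W|}\sum_{g\in W}\omega(g)F(gy),\qquad y\in\Omega .$$ For an open set $U\subset\mathbb R^d$ let $H^1(U)$ be the space of $f\in L^2(U)$ (complex-valued) whose weak partial derivatives of first order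 exist and lie in $L^2(U)$, let $H^1_0(U)$ be the closure of $C_c^\infty(U)$ in $H^1(U)$, and let $\mathfrak t_U[f,g]=\int_U\sum_{j=1}^d\partial_jf\,\overline{\partial_jg}\,dx$ for $f,g\in H^1(U)$. For a dense subspace $D\subset H^1(U)$ of $L^2(U)$, the operator $A$ associated with $\mathfrak t_U|_D$ has domain $\mathrm{Dom}(A)=\{f\in D:\exists\,u\in L^2(U)\ \forall g\in D\ \ \mathfrak t_U[f,g]=\langle u,g\rangle_{L^2(U)}\}$, and $Af=u$. The Neumann Laplacian $-\Delta_{N,U}$ and the Dirichlet Laplacian $-\Delta_{D,U}$ are the operators associated with $\mathfrak t_U$ on $D=H^1(U)$ and $D=H^1_0(U)$, respectively. For a homomorphism $\eta\colon W\to\{1,-1\}$, the $\eta$-Laplacian $-\Delta^+_\eta$ is the operator in $L^2(\Omega_+)$ associated with $\mathfrak t_{\Omega_+}$ on $D=H^1_\eta(\Omega_+):=\{(\mathcal A_\eta F)^+:F\in H^1(\Omega)\}\subset H^1(\Omega_+)$. **Proposition.** For every homomorphism $\eta\colon W\to\{1,-1\}$, $$\mathrm{Dom}(-\Delta^+_\eta)=\{(\mathcal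 A_\eta F)^+:F\in\mathrm{Dom}(-\Delta_{N,\Omega})\}$$ and $$-\Delta^+_\eta\big((\mathcal A_\eta F)^+\big)=\big(\mathcal A_\eta(-\Delta_{N,\Omega}F)\big)^+,\qquad F\in\mathrm{Dom}(-\Delta_{N,\Omega}).$$ Moreover, with $\mathrm{sgn}(g)=\det g$ for $g\in W$, $$\mathrm{Dom}(-\Delta_{D,\Omega_+})=\{(\mathcal A_{\mathrm{sgn}}F)^+:F\in\mathrm{Dom}(-\Delta_{D,\Omega})\}$$ and $$-\Delta_{D,\Omega_+}\big((\mathcal A_{\mathrm{sgn}}F)^+\big)=\big(\mathcal A_{\mathrm{sgn}}(-\Delta_{D,\Omega}F)\big)^+,\qquad F\in\mathrm{Dom}(-\Delta_{D,\Omega}).$$ -/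

import Mathlib

namespace ReflectionLaplacian

noncomputable section

open MeasureTheory TopologicalSpace
open scoped Distributions ComplexConjugate

/-! ## The space `L²` and Sobolev spaces on an open set -/

/-- The Euclidean space `ℝ^d`. -/
abbrev Eu (d : ℕ) : Type := EuclideanSpace ℝ (Fin d)

/-- The complex Hilbert space `L²(U)` (with respect to Lebesgue measure). -/
abbrev L2 {d : ℕ} (U : Opens (Eu d)) : Type := Lp ℂ 2 (volume.restrict (U : Set (Eu d)))

/-- The classical partial derivative `∂_j φ`. -/
def partialDeriv {d : ℕ} (j : Fin d) (φ : Eu d → ℂ) (x : Eu d) : ℂ :=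
  fderiv ℝ φ x (EuclideanSpace.single j 1)

/-- `v ∈ L²(U)` is the `j`-th weak partial derivative of `f ∈ L²(U)` on `U`:
`∫_U f ∂_j φ = - ∫_U v φ` for all `φ ∈ C_c^∞(U)`. -/
def HasWeakPartial {d : ℕ} (U : Opens (Eu d)) (j : Fin d) (f v : L2 U) : Prop :=
  ∀ φ : 𝓓(U, ℂ), ∫ x in (U : Set (Eu d)), f x * partialDeriv j φ x =
    - ∫ x in (U : Set (Eu d)), v x * φ x

theorem memLp_testFunction {d : ℕ} {U : Opens (Eu d)} (φ : 𝓓(U, ℂ)) :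
    MemLp φ 2 (volume.restrict (U : Set (Eu d))) :=
  (φ.continuous.memLp_of_hasCompactSupport φ.hasCompactSupport).restrict _

theorem memLp_partialDeriv {d : ℕ} {U : Opens (Eu d)} (j : Fin d) (φ : 𝓓(U, ℂ)) :
    MemLp (partialDeriv j φ) 2 (volume.restrict (U : Set (Eu d))) := by
  have hc : Continuous (partialDeriv j φ) :=
    (φ.contDiff.continuous_fderiv (by simp)).clm_apply continuous_const
  have hs : HasCompactSupport (partialDeriv j φ) :=
    φ.hasCompactSupport.fderiv_apply (𝕜 := ℝ) _
  exact (hc.memLp_of_hasCompactSupport hs).restrict _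

theorem integrable_L2_mul {d : ℕ} {U : Opens (Eu d)} (f : L2 U) {h : Eu d → ℂ}
    (hh : MemLp h 2 (volume.restrict (U : Set (Eu d)))) :
    Integrable (fun x => f x * h x) (volume.restrict (U : Set (Eu d))) :=
  (Lp.memLp f).integrable_mul hh

theorem integral_L2_add_mul {d : ℕ} {U : Opens (Eu d)} (f g : L2 U) {h : Eu d → ℂ}
    (hh : MemLp h 2 (volume.restrict (U : Set (Eu d)))) :
    ∫ x in (U : Set (Eu d)), (f + g : L2 U) x * h x =
      (∫ x in (U : Set (Eu d)), f x * h x) + ∫ x in (U : Set (Eu d)), g x * h x := by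
  rw [← integral_add (integrable_L2_mul f hh) (integrable_L2_mul g hh)]
  refine integral_congr_ae ?_
  filter_upwards [Lp.coeFn_add f g] with x hx
  rw [hx, Pi.add_apply, add_mul]

theorem integral_L2_smul_mul {d : ℕ} {U : Opens (Eu d)} (c : ℂ) (f : L2 U) (h : Eu d → ℂ) :
    ∫ x in (U : Set (Eu d)), (c • f : L2 U) x * h x =
      c * ∫ x in (U : Set (Eu d)), f x * h x := by
  rw [← integral_const_mul]
  refine integral_congr_ae ?_
  filter_upwards [Lp.coeFn_smul c f] with x hx
  rw [hx, Pi.smul_apply, smul_eq_mul, mul_assoc]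

theorem HasWeakPartial.add {d : ℕ} {U : Opens (Eu d)} {j : Fin d} {f v g w : L2 U}
    (hf : HasWeakPartial U j f v) (hg : HasWeakPartial U j g w) :
    HasWeakPartial U j (f + g) (v + w) := fun φ => by
  rw [integral_L2_add_mul _ _ (memLp_partialDeriv j φ),
    integral_L2_add_mul _ _ (memLp_testFunction φ), hf φ, hg φ, neg_add]

theorem HasWeakPartial.smul {d : ℕ} {U : Opens (Eu d)} {j : Fin d} {f v : L2 U} (c : ℂ)
    (hf : HasWeakPartial U j f v) : HasWeakPartial U j (c • f) (c • v) := fun φ => by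
  rw [integral_L2_smul_mul, integral_L2_smul_mul, hf φ, mul_neg]

theorem hasWeakPartial_zero {d : ℕ} (U : Opens (Eu d)) (j : Fin d) :
    HasWeakPartial U j 0 0 := fun φ => by
  have h := fun ψ : Eu d → ℂ => integral_L2_smul_mul (U := U) 0 0 ψ
  simp only [zero_smul, zero_mul] at h
  rw [h, h, neg_zero]

/-- Weak derivatives are unique. -/
theorem HasWeakPartial.unique {d : ℕ} {U : Opens (Eu d)} {j : Fin d} {f v w : L2 U}
    (hv : HasWeakPartial U j f v) (hw : HasWeakPartial U j f w) : v = w := by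
  have h0 : HasWeakPartial U j 0 (v + (-1 : ℂ) • w) := by
    have := hv.add (hw.smul (-1))
    simpa using this
  set u : L2 U := v + (-1 : ℂ) • w with hu
  have hloc : LocallyIntegrableOn u (U : Set (Eu d)) volume := by
    have h1 : LocallyIntegrable u (volume.restrict (U : Set (Eu d))) :=
      (Lp.memLp u).locallyIntegrable (by norm_num)
    exact locallyIntegrableOn_of_locallyIntegrable_restrict h1
  have hae := U.isOpen.ae_eq_zero_of_integral_contDiff_smul_eq_zero hloc (by
    intro g hg hgc hgs
    let φ : 𝓓(U, ℂ) :=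
      ⟨fun x => (g x : ℂ), Complex.ofRealCLM.contDiff.comp hg,
        hgc.comp_left (g := fun r : ℝ => (r : ℂ)) (by simp),
        (closure_mono (fun x hx => by
          simpa using hx)).trans hgs⟩
    have h1 := h0 φ
    have h2 : ∫ x in (U : Set (Eu d)), (0 : L2 U) x * partialDeriv j φ x = 0 := by
      have h := integral_L2_smul_mul (U := U) 0 0 (partialDeriv j φ)
      simpa only [zero_smul, zero_mul] using h
    rw [h2, eq_comm, neg_eq_zero] at h1
    rw [← setIntegral_eq_integral_of_forall_compl_eq_zero (s := (U : Set (Eu d)))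
      (fun x hx => by
        have : g x = 0 := by
          by_contra hne
          exact hx (hgs (subset_tsupport g hne))
        simp [this]), ← h1]
    refine integral_congr_ae (Filter.Eventually.of_forall fun x => ?_)
    change g x • u x = u x * (g x : ℂ)
    rw [Complex.real_smul, mul_comm])
  have hz : u = 0 := by
    rw [Lp.eq_zero_iff_ae_eq_zero]
    exact (ae_restrict_iff' U.isOpen.measurableSet).2 hae
  have : v - w = 0 := by simpa [hu, sub_eq_add_neg] using hz
  exact sub_eq_zero.1 this

/-- The Sobolev space `H¹(U)`: those `f ∈ L²(U)` all of whose first order weak partial derivatives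
exist and belong to `L²(U)`. -/
def H1 {d : ℕ} (U : Opens (Eu d)) : Submodule ℂ (L2 U) where
  carrier := {f | ∀ j : Fin d, ∃ v : L2 U, HasWeakPartial U j f v}
  add_mem' hf hg j := by
    obtain ⟨v, hv⟩ := hf j
    obtain ⟨w, hw⟩ := hg j
    exact ⟨v + w, hv.add hw⟩
  zero_mem' j := ⟨0, hasWeakPartial_zero U j⟩
  smul_mem' c f hf j := by
    obtain ⟨v, hv⟩ := hf j
    exact ⟨c • v, hv.smul c⟩

/-- The weak partial derivative `∂_j : H¹(U) → L²(U)`. -/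
def weakPartial {d : ℕ} (U : Opens (Eu d)) (j : Fin d) : H1 U →ₗ[ℂ] L2 U where
  toFun f := (f.2 j).choose
  map_add' f g :=
    ((f + g).2 j).choose_spec.unique ((f.2 j).choose_spec.add (g.2 j).choose_spec)
  map_smul' c f := ((c • f).2 j).choose_spec.unique ((f.2 j).choose_spec.smul c)

theorem weakPartial_spec {d : ℕ} (U : Opens (Eu d)) (j : Fin d) (f : H1 U) :
    HasWeakPartial U j f (weakPartial U j f) := (f.2 j).choose_spec

/-- The (classes of) functions from `C_c^∞(U)`, as elements of `H¹(U)`. -/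
def smoothCompact {d : ℕ} (U : Opens (Eu d)) : Submodule ℂ (H1 U) where
  carrier := {f | ∃ φ : 𝓓(U, ℂ), (f : L2 U) =ᵐ[volume.restrict (U : Set (Eu d))] φ}
  add_mem' := by
    rintro f g ⟨φ, hφ⟩ ⟨ψ, hψ⟩
    refine ⟨φ + ψ, ?_⟩
    filter_upwards [hφ, hψ, Lp.coeFn_add (f : L2 U) g] with x h1 h2 h3
    rw [Submodule.coe_add, h3, Pi.add_apply, h1, h2]; rfl
  zero_mem' := ⟨0, by
    filter_upwards [Lp.coeFn_zero ℂ 2 (volume.restrict (U : Set (Eu d)))] with x h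
    rw [Submodule.coe_zero, h]; rfl⟩
  smul_mem' := by
    rintro c f ⟨φ, hφ⟩
    refine ⟨c • φ, ?_⟩
    filter_upwards [hφ, Lp.coeFn_smul c (f : L2 U)] with x h1 h3
    rw [Submodule.coe_smul, h3, Pi.smul_apply, h1]; rfl

/-- The embedding `f ↦ (f, ∂_1 f, …, ∂_d f)` of `H¹(U)` into a product of copies of `L²(U)`; the
topology of `H¹(U)` is the one induced by it. -/
def jet {d : ℕ} (U : Opens (Eu d)) : H1 U →ₗ[ℂ] L2 U × (Fin d → L2 U) :=
  (H1 U).subtype.prod (LinearMap.pi fun j => weakPartial U j)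

/-- `H¹₀(U)`: the closure of `C_c^∞(U)` in `H¹(U)`. -/
def H10 {d : ℕ} (U : Opens (Eu d)) : Submodule ℂ (H1 U) :=
  ((smoothCompact U).map (jet U)).topologicalClosure.comap (jet U)

/-! ## Operators associated with sesquilinear forms -/

section Forms

variable {H : Type*} [NormedAddCommGroup H] [InnerProductSpace ℂ H]

/-- The graph of the operator associated with the restriction to a subspace `D ⊆ K` of the
sesquilinear form `t` on the subspace `K ⊆ H` (`t` is linear in the first variable): the pairs
`(h, u)` with `h ∈ D` and `t[h, h'] = ⟨u, h'⟩` for all `h' ∈ D`. Here `⟨u, h'⟩`, linear in `u`, is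
written `inner ℂ h' u` since Mathlib's inner product is linear in the second variable. -/
def formGraph (K : Submodule ℂ H) (t : K →ₗ[ℂ] K →ₗ⋆[ℂ] ℂ) (D : Submodule ℂ K) :
    Submodule ℂ (H × H) where
  carrier := {p | ∃ h ∈ D, (h : H) = p.1 ∧ ∀ h' ∈ D, t h h' = inner ℂ (h' : H) p.2}
  add_mem' := by
    rintro p q ⟨h, hD, hp, ht⟩ ⟨k, kD, hq, kt⟩
    exact ⟨h + k, D.add_mem hD kD, by simp [hp, hq],
      fun h' hh' => by simp [ht h' hh', kt h' hh']⟩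
  zero_mem' := ⟨0, D.zero_mem, by simp, by simp⟩
  smul_mem' := by
    rintro c p ⟨h, hD, hp, ht⟩
    exact ⟨c • h, D.smul_mem c hD, by simp [hp],
      fun h' hh' => by simp [ht h' hh']⟩

/-- The operator associated with the restriction of the form `t` to `D`: an unbounded operator in
`H`. It is meant for `D` dense in `H`, and then its graph is `formGraph K t D`, see
`graph_formOperator`. -/
def formOperator (K : Submodule ℂ H) (t : K →ₗ[ℂ] K →ₗ⋆[ℂ] ℂ) (D : Submodule ℂ K) :
    H →ₗ.[ℂ] H :=
  (formGraph K t D).toLinearPMap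

theorem graph_formOperator (K : Submodule ℂ H) (t : K →ₗ[ℂ] K →ₗ⋆[ℂ] ℂ) (D : Submodule ℂ K)
    (hD : Dense (D.map K.subtype : Set H)) :
    (formOperator K t D).graph = formGraph K t D := by
  refine Submodule.toLinearPMap_graph_eq _ ?_
  rintro ⟨x, u⟩ ⟨h, -, hx, ht⟩ hx0
  have h0 : h = 0 := Subtype.ext (hx.trans hx0)
  refine hD.eq_zero_of_inner_right (𝕜 := ℂ) ?_
  rintro _ ⟨k, hk, rfl⟩
  have := ht k hk
  simpa [h0] using this.symm

end Forms

/-- The form `t_U[f, g] = ∫_U ∑_j ∂_j f · conj (∂_j g)` on `H¹(U)`. -/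
def gradForm {d : ℕ} (U : Opens (Eu d)) : H1 U →ₗ[ℂ] H1 U →ₗ⋆[ℂ] ℂ :=
  LinearMap.mk₂'ₛₗ (RingHom.id ℂ) (starRingEnd ℂ)
    (fun f g => ∑ j, inner ℂ (weakPartial U j g) (weakPartial U j f))
    (fun f f' g => by simp [inner_add_right, Finset.sum_add_distrib])
    (fun c f g => by simp [inner_smul_right, Finset.mul_sum])
    (fun f g g' => by simp [inner_add_left, Finset.sum_add_distrib])
    (fun c f g => by simp [inner_smul_left, Finset.mul_sum])

theorem gradForm_eq_integral {d : ℕ} (U : Opens (Eu d)) (f g : H1 U) :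
    gradForm U f g = ∫ x in (U : Set (Eu d)),
      ∑ j, weakPartial U j f x * conj (weakPartial U j g x) := by
  rw [integral_finsetSum _ fun j _ => ?_]
  · simp [gradForm, L2.inner_def]
  · simpa using L2.integrable_inner (𝕜 := ℂ) (weakPartial U j g) (weakPartial U j f)

/-- The Neumann Laplacian `-Δ_{N,U}`, associated with the form `t_U` on `H¹(U)`. -/
def neumannLaplacian {d : ℕ} (U : Opens (Eu d)) : L2 U →ₗ.[ℂ] L2 U :=
  formOperator (H1 U) (gradForm U) ⊤

/-- The Dirichlet Laplacian `-Δ_{D,U}`, associated with the form `t_U` restricted to `H¹₀(U)`. -/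
def dirichletLaplacian {d : ℕ} (U : Opens (Eu d)) : L2 U →ₗ.[ℂ] L2 U :=
  formOperator (H1 U) (gradForm U) (H10 U)

/-! ## Finite reflection groups -/

/-- The orthogonal reflection `x ↦ x - 2⟨α, x⟩α` in the hyperplane orthogonal to the unit
vector `α`. -/
abbrev refl {d : ℕ} (α : Eu d) : Eu d ≃ₗᵢ[ℝ] Eu d := (ℝ ∙ α)ᗮ.reflection

/-- A normalized root system in `ℝ^d`: a finite set `R` of unit vectors with `σ_α(R) = R` for
every `α ∈ R`. -/
structure NormalizedRootSystem (d : ℕ) where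
  roots : Set (Eu d)
  finite : roots.Finite
  norm_eq_one : ∀ α ∈ roots, ‖α‖ = 1
  image_refl : ∀ α ∈ roots, refl α '' roots = roots

namespace NormalizedRootSystem

variable {d : ℕ} (R : NormalizedRootSystem d)

/-- The finite reflection group `W(R)`, generated by the reflections `σ_α`, `α ∈ R`. -/
def weylGroup : Subgroup (Eu d ≃ₗᵢ[ℝ] Eu d) := Subgroup.closure (refl '' R.roots)

theorem weylGroup_image_eq {S : Set (Eu d)} (hS : ∀ α ∈ R.roots, refl α '' S = S)
    {g : Eu d ≃ₗᵢ[ℝ] Eu d} (hg : g ∈ R.weylGroup) : g '' S = S := by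
  induction hg using Subgroup.closure_induction with
  | mem x hx => obtain ⟨α, hα, rfl⟩ := hx; exact hS α hα
  | one => simp
  | mul x y _ _ hx hy =>
    rw [LinearIsometryEquiv.coe_mul, Set.image_comp, hy, hx]
  | inv x _ hx =>
    conv_lhs => rw [← hx]
    rw [← Set.image_comp, ← LinearIsometryEquiv.coe_mul, inv_mul_cancel]
    simp

theorem weylGroup_fix_orthogonal {g : Eu d ≃ₗᵢ[ℝ] Eu d} (hg : g ∈ R.weylGroup) {x : Eu d}
    (hx : x ∈ (Submodule.span ℝ R.roots)ᗮ) : g x = x := by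
  induction hg using Subgroup.closure_induction with
  | mem y hy =>
    obtain ⟨α, hα, rfl⟩ := hy
    refine Submodule.reflection_mem_subspace_eq_self ?_
    refine Submodule.orthogonal_le ?_ hx
    exact Submodule.span_mono (Set.singleton_subset_iff.2 hα)
  | one => rfl
  | mul y z _ _ hy hz => rw [LinearIsometryEquiv.coe_mul, Function.comp_apply, hz, hy]
  | inv y _ hy =>
    conv_lhs => rw [← hy]
    exact y.symm_apply_apply x

instance finite_weylGroup : Finite R.weylGroup := by
  have : Finite R.roots := R.finite
  let Φ : R.weylGroup → (R.roots → R.roots) := fun g α =>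
    ⟨g.1 α, by
      have h := R.weylGroup_image_eq R.image_refl g.2
      exact h.subset (Set.mem_image_of_mem _ α.2)⟩
  refine Finite.of_injective Φ fun g h hgh => ?_
  have hroot : ∀ α ∈ R.roots, g.1 α = h.1 α := fun α hα =>
    congrArg Subtype.val (congrFun hgh ⟨α, hα⟩)
  refine Subtype.ext (LinearIsometryEquiv.ext fun x => ?_)
  obtain ⟨y, hy, z, hz, rfl⟩ := (Submodule.span ℝ R.roots).exists_add_mem_mem_orthogonal x
  have h1 : g.1 y = h.1 y :=
    LinearMap.eqOn_span (f := (g.1.toLinearEquiv : Eu d →ₗ[ℝ] Eu d))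
      (g := (h.1.toLinearEquiv : Eu d →ₗ[ℝ] Eu d)) (fun α hα => hroot α hα) hy
  rw [map_add, map_add, h1, R.weylGroup_fix_orthogonal g.2 hz, R.weylGroup_fix_orthogonal h.2 hz]

instance fintype_weylGroup : Fintype R.weylGroup := Fintype.ofFinite _

/-- The weight `sgn(g) = det(g)` on `W`. -/
def sgn (g : R.weylGroup) : ℂ :=
  ((LinearMap.det (g.1.toLinearEquiv : Eu d →ₗ[ℝ] Eu d) : ℝ) : ℂ)

/-- The weight on `W` given by a homomorphism `η : W → {1, -1}`. -/
def homWeight {R : NormalizedRootSystem d} (η : R.weylGroup →* ℤˣ) (g : R.weylGroup) : ℂ :=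
  ((η g : ℤ) : ℂ)

/-- The set `R_+` of positive roots determined by a vector `c`. -/
def posRoots (c : Eu d) : Set (Eu d) := {α ∈ R.roots | 0 < inner ℝ α c}

/-- The positive Weyl chamber `C_+` determined by a vector `c`. -/
def chamber (c : Eu d) : Opens (Eu d) where
  carrier := {x | ∀ α ∈ R.posRoots c, 0 < inner ℝ x α}
  is_open' := by
    have hfin : (R.posRoots c).Finite := R.finite.subset fun _ h => h.1
    have : {x : Eu d | ∀ α ∈ R.posRoots c, 0 < inner ℝ x α} =
        ⋂ α ∈ R.posRoots c, {x : Eu d | 0 < inner ℝ x α} := by ext; simp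
    rw [this]
    exact hfin.isOpen_biInter fun α _ =>
      isOpen_lt continuous_const (continuous_id.inner continuous_const)

/-- `Ω` is `W`-symmetric: `σ_α(Ω) = Ω` for every root `α`. -/
def IsSymmetric (Ω : Opens (Eu d)) : Prop :=
  ∀ α ∈ R.roots, refl α '' (Ω : Set (Eu d)) = (Ω : Set (Eu d))

/-- The positive part `Ω_+ = Ω ∩ C_+` of `Ω`. -/
def posPart (c : Eu d) (Ω : Opens (Eu d)) : Opens (Eu d) := Ω ⊓ R.chamber c

theorem posPart_le (c : Eu d) (Ω : Opens (Eu d)) : R.posPart c Ω ≤ Ω := inf_le_left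

variable {R}

theorem IsSymmetric.measurePreserving {Ω : Opens (Eu d)} (hΩ : R.IsSymmetric Ω)
    (g : R.weylGroup) :
    MeasurePreserving g.1 (volume.restrict (Ω : Set (Eu d)))
      (volume.restrict (Ω : Set (Eu d))) := by
  have h := g.1.measurePreserving.restrict_preimage_emb
    g.1.toHomeomorph.measurableEmbedding (Ω : Set (Eu d))
  have hpre : g.1 ⁻¹' (Ω : Set (Eu d)) = Ω := by
    conv_lhs => rw [← R.weylGroup_image_eq hΩ g.2]
    exact Set.preimage_image_eq _ g.1.injective
  rwa [hpre] at h

/-- The weighted averaging operator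
`(A_ω F)(y) = |W|⁻¹ ∑_{g ∈ W} ω(g) F(g y)` on `L²(Ω)`. -/
def average {Ω : Opens (Eu d)} (hΩ : R.IsSymmetric Ω) (ω : R.weylGroup → ℂ) :
    L2 Ω →ₗ[ℂ] L2 Ω :=
  (Fintype.card R.weylGroup : ℂ)⁻¹ • ∑ g : R.weylGroup,
    ω g • Lp.compMeasurePreservingₗ ℂ g.1 (hΩ.measurePreserving g)

end NormalizedRootSystem

/-! ## Restriction to the positive part and the `η`-Laplacian -/

/-- The restriction operator `L²(U) → L²(V)`, `V ⊆ U`. -/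
def restrictL2 {d : ℕ} {U V : Opens (Eu d)} (h : V ≤ U) : L2 U →ₗ[ℂ] L2 V where
  toFun f := ((Lp.memLp f).mono_measure (Measure.restrict_mono h le_rfl)).toLp f
  map_add' f g := by
    rw [← MemLp.toLp_add]
    exact MemLp.toLp_congr _ _
      (ae_mono (Measure.restrict_mono h le_rfl) (Lp.coeFn_add f g))
  map_smul' c f := by
    rw [RingHom.id_apply, ← MemLp.toLp_const_smul]
    exact MemLp.toLp_congr _ _
      (ae_mono (Measure.restrict_mono h le_rfl) (Lp.coeFn_smul c f))

namespace NormalizedRootSystem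

variable {d : ℕ} {R : NormalizedRootSystem d}

/-- The operator `F ↦ (A_ω F)^+` from `L²(Ω)` to `L²(Ω_+)`. -/
def averagePos (c : Eu d) {Ω : Opens (Eu d)} (hΩ : R.IsSymmetric Ω) (ω : R.weylGroup → ℂ) :
    L2 Ω →ₗ[ℂ] L2 (R.posPart c Ω) :=
  restrictL2 (R.posPart_le c Ω) ∘ₗ average hΩ ω

/-- The space `H¹_η(Ω_+) = (A_η H¹(Ω))^+`, as a subspace of `H¹(Ω_+)` (note that `A_η` maps `H¹(Ω)`
into itself, so that every element of `(A_η H¹(Ω))^+` belongs to `H¹(Ω_+)`). -/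
def H1eta (c : Eu d) {Ω : Opens (Eu d)} (hΩ : R.IsSymmetric Ω) (η : R.weylGroup →* ℤˣ) :
    Submodule ℂ (H1 (R.posPart c Ω)) :=
  ((H1 Ω).map (averagePos c hΩ (homWeight η))).comap (H1 (R.posPart c Ω)).subtype

/-- The `η`-Laplacian `-Δ^+_η` on `Ω_+`, associated with the restriction to `H¹_η(Ω_+)` of the form
`t^+[f, g] = ∫_{Ω_+} ∑_j ∂_j f · conj (∂_j g)`. -/
def etaLaplacian (c : Eu d) {Ω : Opens (Eu d)} (hΩ : R.IsSymmetric Ω) (η : R.weylGroup →* ℤˣ) :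
    L2 (R.posPart c Ω) →ₗ.[ℂ] L2 (R.posPart c Ω) :=
  formOperator (H1 (R.posPart c Ω)) (gradForm (R.posPart c Ω)) (H1eta c hΩ η)

end NormalizedRootSystem

end

end ReflectionLaplacian

open ReflectionLaplacian
open ReflectionLaplacian.NormalizedRootSystem (etaLaplacian averagePos homWeight)

namespace ReflectionLaplacian

noncomputable section

open MeasureTheory TopologicalSpace Filter Topology
open scoped Distributions ComplexConjugate NNReal

/-! ## Simple transitivity of the reflection group on the chambers -/

/-! For a character $\omega$ with values $\pm1$, $\mathcal A_\omega$ is the orthogonal projection of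
$L^2(\Omega)$ onto the functions with $F\circ g=\omega(g)F$. Up to null sets $\Omega$ is tiled by
the images of $\Omega_+$ under $W$, and an equivariant function is determined by its values on one
tile. Hence, for equivariant functions, inner products and gradient forms over $\Omega$ are $|W|$
times those over $\Omega_+$ (`inner_eq_card_mul_inner_restrictPos`, `gradForm_averageH1_averageH1`).
Both pairings are $W$-invariant, so $\mathcal A_\omega$ moves freely between their two arguments,
and the weak equation $\mathfrak t[f,g]=\langle u,g\rangle$ passes between $\Omega$ and $\Omega_+$
in both directions. This is `formOperator_averagePos`, valid for every form domain $D$ on $\Omega$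
that is invariant under averaging and whose only orthogonal vector in $L^2(\Omega)$ is zero; the
form domain on $\Omega_+$ has to be $(\mathcal A_\omega D)^+$.

The tiling rests on the simple transitivity of $W$ on the chambers. Transitivity comes from
maximizing $\langle gx,\check\alpha\rangle$ over $g$; freeness comes from simple roots and the
exchange condition.

In the Neumann case the form domain on $\Omega_+$ is $(\mathcal A_\eta H^1(\Omega))^+$ by
definition. In the Dirichlet case one needs $H^1_0(\Omega_+)=(\mathcal
A_{\mathrm{sgn}}H^1_0(\Omega))^+$ (`mem_H10_posPart_iff`). Extension by zero gives one inclusion.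
For the other, an antisymmetric test function vanishes on the walls, and cutting off its small
values gives test functions on $\Omega_+$ converging to it in $H^1$
(`restrictPosH1_testH1_mem_H10`); no trace theory or boundary regularity is involved. -/

theorem refl_apply {d : ℕ} {α : Eu d} (hα : ‖α‖ = 1) (x : Eu d) :
    refl α x = x - (2 * inner ℝ α x) • α := by
  rw [Submodule.reflection_orthogonal_apply, Submodule.reflection_singleton_apply, hα]
  simp [two_smul, two_mul, add_smul]

theorem refl_self {d : ℕ} (α : Eu d) : refl α α = -α :=
  Submodule.reflection_orthogonalComplement_singleton_eq_neg α

theorem refl_refl {d : ℕ} (α x : Eu d) : refl α (refl α x) = x :=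
  Submodule.reflection_reflection _ x

theorem mul_refl_mul_inv {d : ℕ} (g : Eu d ≃ₗᵢ[ℝ] Eu d) {α : Eu d} (hα : ‖α‖ = 1) :
    g * refl α * g⁻¹ = refl (g α) := by
  refine LinearIsometryEquiv.ext fun x => ?_
  have h : inner ℝ α (g⁻¹ x) = inner ℝ (g α) x := by
    rw [← g.inner_map_map]
    congr 1
    exact g.apply_symm_apply x
  have hx : g (g⁻¹ x) = x := g.apply_symm_apply x
  rw [LinearIsometryEquiv.coe_mul, LinearIsometryEquiv.coe_mul, Function.comp_apply,
    Function.comp_apply, refl_apply hα, refl_apply (by rw [g.norm_map, hα]), map_sub, map_smul, h,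
    hx]

namespace NormalizedRootSystem

variable {d : ℕ} {R : NormalizedRootSystem d} {c : Eu d}

theorem apply_mem_roots {g : Eu d ≃ₗᵢ[ℝ] Eu d} (hg : g ∈ R.weylGroup) {α : Eu d}
    (hα : α ∈ R.roots) : g α ∈ R.roots :=
  (R.weylGroup_image_eq R.image_refl hg).subset (Set.mem_image_of_mem _ hα)

theorem refl_mem_weylGroup {α : Eu d} (hα : α ∈ R.roots) : refl α ∈ R.weylGroup :=
  Subgroup.subset_closure (Set.mem_image_of_mem _ hα)

theorem neg_mem_roots {α : Eu d} (hα : α ∈ R.roots) : -α ∈ R.roots := by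
  rw [← refl_self]
  exact apply_mem_roots (refl_mem_weylGroup hα) hα

theorem mem_posRoots_or_neg (hc : ∀ α ∈ R.roots, inner ℝ α c ≠ 0) {α : Eu d} (hα : α ∈ R.roots) :
    α ∈ R.posRoots c ∨ -α ∈ R.posRoots c := by
  rcases lt_or_gt_of_ne (hc α hα) with h | h
  · exact Or.inr ⟨neg_mem_roots hα, by rw [inner_neg_left]; linarith⟩
  · exact Or.inl ⟨hα, h⟩

theorem neg_notMem_posRoots {α : Eu d} (hα : α ∈ R.posRoots c) : -α ∉ R.posRoots c := by
  intro h
  have h1 := hα.2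
  have h2 := h.2
  rw [inner_neg_left] at h2
  linarith

/-! ### Simple roots, simple reflections and the exchange condition. -/

theorem eq_zero_or_inner_pos {S : Set (Eu d)} (hS : S ⊆ R.posRoots c) {x : Eu d}
    (hx : x ∈ Submodule.span ℝ≥0 S) : x = 0 ∨ 0 < inner ℝ x c := by
  induction hx using Submodule.span_induction with
  | mem x hx => exact Or.inr (hS hx).2
  | zero => exact Or.inl rfl
  | add x y _ _ hx hy =>
    rcases hx with rfl | hx
    · simpa using hy
    · rcases hy with rfl | hy
      · right; simpa using hx
      · right; rw [inner_add_left]; linarith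
  | smul a x _ hx =>
    rcases hx with rfl | hx
    · simp
    · rcases eq_or_ne a 0 with rfl | ha
      · simp
      · right
        rw [NNReal.smul_def, real_inner_smul_left]
        exact mul_pos (by positivity) hx

variable (R c) in
/-- A system of simple roots for the positive roots `R_+`: a subset of `R_+` whose cone contains
`R_+`, and each of whose reflections preserves all positive roots but one. -/
structure IsSimpleSystem (S : Set (Eu d)) : Prop where
  subset : S ⊆ R.posRoots c
  le_span : R.posRoots c ⊆ Submodule.span ℝ≥0 S
  refl_mem : ∀ α ∈ S, ∀ β ∈ R.posRoots c, β ≠ α → refl α β ∈ R.posRoots c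

-- Simplicity is obtained from minimality: $S$ is a minimal subset of $R_+$ whose cone contains
-- $R_+$. No linear independence of $S$ is needed.
variable (R c) in
theorem exists_isSimpleSystem (hc : ∀ α ∈ R.roots, inner ℝ α c ≠ 0) :
    ∃ S, R.IsSimpleSystem c S := by
  have hfin : (R.posRoots c).Finite := R.finite.subset fun _ h => h.1
  obtain ⟨S, hS⟩ := Set.Finite.exists_minimal
    (s := {S | S ⊆ R.posRoots c ∧ R.posRoots c ⊆ Submodule.span ℝ≥0 S})
    (hfin.finite_subsets.subset fun S h => h.1)
    ⟨R.posRoots c, subset_rfl, Submodule.subset_span⟩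
  refine ⟨S, hS.1.1, hS.1.2, fun α hα β hβ hne => ?_⟩
  by_contra hcon
  -- By minimality no simple root is redundant.
  have hmin : α ∉ Submodule.span ℝ≥0 (S \ {α}) := by
    intro hmem
    have hle : S ⊆ Submodule.span ℝ≥0 (S \ {α}) := by
      intro x hx
      by_cases h : x = α
      · rwa [h]
      · exact Submodule.subset_span ⟨hx, h⟩
    have := hS.2 (y := S \ {α}) ⟨Set.sdiff_subset.trans hS.1.1,
      hS.1.2.trans (Submodule.span_le.2 hle)⟩ Set.sdiff_subset hα
    exact this.2 rfl
  have hα1 := R.norm_eq_one α (hS.1.1 hα).1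
  have hroot : refl α β ∈ R.roots := apply_mem_roots (refl_mem_weylGroup (hS.1.1 hα).1) hβ.1
  have hneg : -refl α β ∈ R.posRoots c := (mem_posRoots_or_neg hc hroot).resolve_left hcon
  have hins : insert α (S \ {α}) = S := by simp [Set.insert_eq_of_mem hα]
  have h1 := hS.1.2 hβ
  have h2 := hS.1.2 hneg
  rw [← hins] at h1 h2
  obtain ⟨a, z, hz, h1⟩ := Submodule.mem_span_insert.1 h1
  obtain ⟨b, w, hw, h2⟩ := Submodule.mem_span_insert.1 h2
  rw [refl_apply hα1] at h2
  set k : ℝ := 2 * inner ℝ α β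
  -- Here $\beta=a\alpha+z$ and $-\sigma_\alpha\beta=b\alpha+w$ are added. A positive coefficient
  -- puts $\alpha$ in the cone of the other simple roots; otherwise pairing with $\check\alpha$
  -- forces $z=0$, so $\beta$ is a nonnegative multiple of $\alpha$ and equals it by normalization.
  have hsum : (k - a - b) • α = z + w := by
    have : k • α = a • α + z + (b • α + w) := by rw [← h1, ← h2]; abel
    rw [sub_smul, sub_smul, this, NNReal.smul_def, NNReal.smul_def]; abel
  have hzw := Submodule.add_mem _ hz hw
  rcases lt_or_ge 0 (k - a - b) with hk | hk
  · refine hmin ?_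
    have h3 := Submodule.smul_mem _ (Real.toNNReal (k - a - b))⁻¹ hzw
    rwa [← hsum, NNReal.smul_def, NNReal.coe_inv, Real.coe_toNNReal _ hk.le,
      inv_smul_smul₀ hk.ne'] at h3
  · have hz0 := eq_zero_or_inner_pos (Set.sdiff_subset.trans hS.1.1) hz
    have hw0 := eq_zero_or_inner_pos (Set.sdiff_subset.trans hS.1.1) hw
    have hin : (k - a - b) * inner ℝ α c = inner ℝ z c + inner ℝ w c := by
      rw [← real_inner_smul_left, hsum, inner_add_left]
    have hαc := (hS.1.1 hα).2
    have hle : (k - a - b) * inner ℝ α c ≤ 0 := mul_nonpos_of_nonpos_of_nonneg hk hαc.le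
    have hz00 : z = 0 := by
      rcases hz0 with h | h
      · exact h
      · rcases hw0 with h' | h'
        · rw [h', inner_zero_left] at hin; linarith
        · linarith
    rw [hz00, add_zero, NNReal.smul_def] at h1
    have hn := R.norm_eq_one β hβ.1
    rw [h1, norm_smul, hα1, mul_one, Real.norm_of_nonneg (NNReal.coe_nonneg a)] at hn
    rw [hn, one_smul] at h1
    exact hne h1

namespace IsSimpleSystem

variable {S : Set (Eu d)}

theorem mem_roots (hS : R.IsSimpleSystem c S) {α : Eu d} (hα : α ∈ S) : α ∈ R.roots :=
  (hS.subset hα).1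

theorem norm_eq_one (hS : R.IsSimpleSystem c S) {α : Eu d} (hα : α ∈ S) : ‖α‖ = 1 :=
  R.norm_eq_one α (hS.mem_roots hα)

/-- Otherwise $\beta$, being in the cone of $S$, would satisfy $\langle\beta,\beta\rangle\le0$. -/
theorem exists_inner_pos (hS : R.IsSimpleSystem c S) {β : Eu d} (hβ : β ∈ R.posRoots c) :
    ∃ α ∈ S, 0 < inner ℝ α β := by
  by_contra! hcon
  have : ∀ x ∈ Submodule.span ℝ≥0 S, inner ℝ x β ≤ 0 := by
    intro x hx
    induction hx using Submodule.span_induction with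
    | mem x hx => exact hcon x hx
    | zero => simp
    | add x y _ _ hx hy => rw [inner_add_left]; linarith
    | smul a x _ hx =>
      rw [NNReal.smul_def, real_inner_smul_left]
      exact mul_nonpos_of_nonneg_of_nonpos a.2 hx
  have h := this β (hS.le_span hβ)
  rw [real_inner_self_eq_norm_sq, R.norm_eq_one β hβ.1] at h
  norm_num at h

/-- Descent on the height $\langle\beta,\check\alpha\rangle$: a simple $\alpha$ with
$\langle\alpha,\gamma\rangle>0$ makes $\sigma_\alpha\gamma$ a lower positive root, and
$\sigma_\gamma$ is the conjugate of $\sigma_{\sigma_\alpha\gamma}$ by $\sigma_\alpha$. -/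
theorem refl_mem_closure (hS : R.IsSimpleSystem c S) {β : Eu d} (hβ : β ∈ R.posRoots c) :
    refl β ∈ Subgroup.closure (refl '' S) := by
  have hfin : (R.posRoots c).Finite := R.finite.subset fun _ h => h.1
  by_contra hcon
  obtain ⟨γ, hγ, hmin⟩ := (hfin.inter_of_left
    {β | refl β ∉ Subgroup.closure (refl '' S)}).exists_minimalFor (fun β => inner ℝ β c) _
    ⟨β, hβ, hcon⟩
  obtain ⟨α, hα, hpos⟩ := hS.exists_inner_pos hγ.1
  have hα1 := hS.norm_eq_one hα
  have hαmem : refl α ∈ Subgroup.closure (refl '' S) :=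
    Subgroup.subset_closure (Set.mem_image_of_mem _ hα)
  have hne : γ ≠ α := fun h => hγ.2 (h ▸ hαmem)
  have hmem := hS.refl_mem α hα γ hγ.1 hne
  have hlt : inner ℝ (refl α γ) c < inner ℝ γ c := by
    rw [refl_apply hα1, inner_sub_left, real_inner_smul_left]
    have := mul_pos (mul_pos two_pos hpos) (hS.subset hα).2
    linarith
  by_cases h : refl (refl α γ) ∈ Subgroup.closure (refl '' S)
  · refine hγ.2 ?_
    have h2 := mul_refl_mul_inv (refl α) (α := refl α γ) (R.norm_eq_one _ hmem.1)
    rw [refl_refl] at h2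
    rw [← h2]
    exact mul_mem (mul_mem hαmem h) (inv_mem hαmem)
  · exact absurd (hmin ⟨hmem, h⟩ hlt.le) (not_le.2 hlt)

theorem weylGroup_eq (hS : R.IsSimpleSystem c S) (hc : ∀ α ∈ R.roots, inner ℝ α c ≠ 0) :
    R.weylGroup = Subgroup.closure (refl '' S) := by
  refine le_antisymm ((Subgroup.closure_le _).2 ?_)
    (Subgroup.closure_mono (Set.image_mono fun α hα => hS.mem_roots hα))
  rintro _ ⟨α, hα, rfl⟩
  rcases mem_posRoots_or_neg hc hα with h | h
  · exact hS.refl_mem_closure h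
  · have := hS.refl_mem_closure h
    have h2 : refl (-α) = refl α := by
      refine LinearIsometryEquiv.ext fun x => ?_
      rw [refl_apply (R.norm_eq_one _ h.1), refl_apply (R.norm_eq_one _ hα)]
      simp
    rwa [h2] at this

theorem exists_list (hS : R.IsSimpleSystem c S) (hc : ∀ α ∈ R.roots, inner ℝ α c ≠ 0)
    {g : Eu d ≃ₗᵢ[ℝ] Eu d} (hg : g ∈ R.weylGroup) :
    ∃ L : List (Eu d), (∀ α ∈ L, α ∈ S) ∧ (L.map refl).prod = g := by
  rw [hS.weylGroup_eq hc] at hg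
  induction hg using Subgroup.closure_induction with
  | mem x hx =>
    obtain ⟨α, hα, rfl⟩ := hx
    exact ⟨[α], by simpa using hα, by simp⟩
  | one => exact ⟨[], by simp, by simp⟩
  | mul x y _ _ hx hy =>
    obtain ⟨L, hL, rfl⟩ := hx
    obtain ⟨M, hM, rfl⟩ := hy
    refine ⟨L ++ M, fun α hα => ?_, by simp⟩
    rcases List.mem_append.1 hα with h | h
    · exact hL α h
    · exact hM α h
  | inv x _ hx =>
    obtain ⟨L, hL, rfl⟩ := hx
    refine ⟨L.reverse, fun α hα => hL α (List.mem_reverse.1 hα), ?_⟩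
    rw [List.prod_inv_reverse, List.map_map, List.map_reverse]
    congr 3

/-- The exchange condition. -/
theorem exchange (hS : R.IsSimpleSystem c S) {L : List (Eu d)} (hL : ∀ α ∈ L, α ∈ S) {α : Eu d}
    (hα : α ∈ S) (h : (L.map refl).prod α ∉ R.posRoots c) :
    ∃ L' : List (Eu d), (∀ α ∈ L', α ∈ S) ∧ (L'.map refl).prod = (L.map refl).prod * refl α ∧
      L'.length + 1 = L.length := by
  induction L with
  | nil => exact absurd (hS.subset hα) (by simpa using h)
  | cons a L ih =>
    have hL1 : ∀ α ∈ L, α ∈ S := fun β hβ => hL β (List.mem_cons_of_mem _ hβ)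
    have ha : a ∈ S := hL a List.mem_cons_self
    by_cases h1 : (L.map refl).prod α ∈ R.posRoots c
    -- The letter $a$ is where the root turns negative. Since $\sigma_a$ makes only $a$ negative,
    -- the root is $a$ there, and $\sigma_a=w\sigma_\alpha w^{-1}$ with $w$ the product of $L$; so
    -- $\sigma_a$ cancels against $\sigma_\alpha$.
    · have h2 : (L.map refl).prod α = a := by
        by_contra hne
        exact h (by simpa using hS.refl_mem a ha _ h1 hne)
      have h3 := mul_refl_mul_inv (L.map refl).prod (hS.norm_eq_one hα)
      rw [h2] at h3
      refine ⟨L, hL1, ?_, by simp⟩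
      rw [List.map_cons, List.prod_cons, ← h3]
      simp [mul_assoc]
    · obtain ⟨L', h1, h2, h3⟩ := ih hL1 h1
      refine ⟨a :: L', fun β hβ => ?_, by simp [h2, mul_assoc], by simp [h3]⟩
      rcases List.mem_cons.1 hβ with h | h
      · exact h ▸ ha
      · exact h1 β h

/-- If a shortest word for $g$ ended in $\sigma_\alpha$, then $g\alpha>0$ would mean that the word
without its last letter makes $\alpha$ negative, and the exchange condition would give a word for
$g$ shorter by two letters. -/
theorem eq_one_of_forall_mem (hS : R.IsSimpleSystem c S) (hc : ∀ α ∈ R.roots, inner ℝ α c ≠ 0)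
    {g : Eu d ≃ₗᵢ[ℝ] Eu d} (hg : g ∈ R.weylGroup)
    (h : ∀ α ∈ R.posRoots c, g α ∈ R.posRoots c) : g = 1 := by
  classical
  have hex : ∃ n, ∃ L : List (Eu d), (∀ α ∈ L, α ∈ S) ∧ (L.map refl).prod = g ∧ L.length = n := by
    obtain ⟨L, h1, h2⟩ := hS.exists_list hc hg
    exact ⟨_, L, h1, h2, rfl⟩
  obtain ⟨L, hL, hprod, hlen⟩ := Nat.find_spec hex
  rcases List.eq_nil_or_concat' L with rfl | ⟨L1, α, rfl⟩
  · simpa using hprod.symm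
  · exfalso
    have hα : α ∈ S := hL α (by simp)
    have hL1 : ∀ α ∈ L1, α ∈ S := fun β hβ => hL β (by simp [hβ])
    have h1 := h α (hS.subset hα)
    have h2 : g = (L1.map refl).prod * refl α := by rw [← hprod]; simp
    have h3 : (L1.map refl).prod α ∉ R.posRoots c := by
      rw [h2, LinearIsometryEquiv.coe_mul, Function.comp_apply, refl_self, map_neg] at h1
      intro h4
      exact neg_notMem_posRoots h4 h1
    obtain ⟨L', h4, h5, h6⟩ := hS.exchange hL1 hα h3
    refine Nat.find_min hex (m := L'.length) ?_ ⟨L', h4, h5.trans h2.symm, rfl⟩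
    rw [← hlen, List.length_append]
    simp; omega

end IsSimpleSystem

/-- The reflection group acts freely on the set of chambers. -/
theorem eq_one_of_apply_mem_chamber (hc : ∀ α ∈ R.roots, inner ℝ α c ≠ 0)
    {g : Eu d ≃ₗᵢ[ℝ] Eu d} (hg : g ∈ R.weylGroup) {x : Eu d} (hx : x ∈ R.chamber c)
    (hgx : g x ∈ R.chamber c) : g = 1 := by
  obtain ⟨S, hS⟩ := R.exists_isSimpleSystem c hc
  -- As $\langle gx,g\alpha\rangle=\langle x,\alpha\rangle>0$ and $gx\in C_+$, the root $g\alpha$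
  -- cannot be negative.
  refine hS.eq_one_of_forall_mem hc hg fun α hα => ?_
  have h1 : 0 < inner ℝ x α := hx α hα
  rw [← g.inner_map_map] at h1
  refine (mem_posRoots_or_neg hc (apply_mem_roots hg hα.1)).resolve_right fun h => ?_
  have h2 : 0 < inner ℝ (g x) (-g α) := hgx _ h
  rw [inner_neg_right] at h2
  linarith

/-- The reflection group acts transitively on the set of chambers. -/
theorem exists_apply_mem_chamber {x : Eu d} (hx : ∀ α ∈ R.roots, inner ℝ x α ≠ 0) :
    ∃ g : R.weylGroup, g.1 x ∈ R.chamber c := by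
  -- If $\langle gx,\alpha\rangle<0$ for a positive $\alpha$, reflecting $gx$ in $\alpha$ would
  -- increase its pairing with $\check\alpha$.
  obtain ⟨g, hg⟩ := Finite.exists_max fun g : R.weylGroup => inner ℝ (g.1 x) c
  refine ⟨g, fun α hα => ?_⟩
  have hα1 := R.norm_eq_one α hα.1
  have h := hg (⟨refl α, refl_mem_weylGroup hα.1⟩ * g)
  have h1 : inner ℝ (refl α (g.1 x)) c ≤ inner ℝ (g.1 x) c := h
  rw [refl_apply hα1, inner_sub_left, real_inner_smul_left,
    real_inner_comm (g.1 x) α] at h1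
  have h2 : 0 ≤ inner ℝ (g.1 x) α := by
    by_contra! hneg
    have := mul_neg_of_neg_of_pos hneg hα.2
    linarith
  refine lt_of_le_of_ne h2 fun h0 => hx (g.1⁻¹ α) (apply_mem_roots (inv_mem g.2) hα.1) ?_
  rw [← g.1.inner_map_map, show g.1 (g.1⁻¹ α) = α from g.1.apply_symm_apply α]
  exact h0.symm

end NormalizedRootSystem

/-! ## Restriction, extension by zero and pullback on `L²` -/

theorem coeFn_restrictL2 {d : ℕ} {U V : Opens (Eu d)} (h : V ≤ U) (f : L2 U) :
    restrictL2 h f =ᵐ[volume.restrict (V : Set (Eu d))] f :=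
  MemLp.coeFn_toLp ((Lp.memLp f).mono_measure (Measure.restrict_mono h le_rfl))

theorem continuous_restrictL2 {d : ℕ} {U V : Opens (Eu d)} (h : V ≤ U) :
    Continuous (restrictL2 h) := by
  refine ((restrictL2 h).mkContinuous 1 fun f => ?_).continuous
  rw [one_mul, Lp.norm_def, Lp.norm_def]
  refine ENNReal.toReal_mono (Lp.eLpNorm_ne_top f) ?_
  rw [eLpNorm_congr_ae (coeFn_restrictL2 h f)]
  exact eLpNorm_mono_measure _ (Measure.restrict_mono h le_rfl)

theorem restrict_restrict_opens {d : ℕ} {U V : Opens (Eu d)} (h : V ≤ U) :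
    ((volume : Measure (Eu d)).restrict (U : Set (Eu d))).restrict (V : Set (Eu d)) =
      volume.restrict (V : Set (Eu d)) :=
  Measure.restrict_restrict_of_subset h

theorem memLp_indicator {d : ℕ} {U V : Opens (Eu d)} (h : V ≤ U) (f : L2 V) :
    MemLp ((V : Set (Eu d)).indicator f) 2 (volume.restrict (U : Set (Eu d))) := by
  rw [memLp_indicator_iff_restrict V.isOpen.measurableSet, restrict_restrict_opens h]
  exact Lp.memLp f

theorem indicator_ae_eq {d : ℕ} {U V : Opens (Eu d)} (h : V ≤ U) {f g : Eu d → ℂ}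
    (hfg : f =ᵐ[volume.restrict (V : Set (Eu d))] g) :
    (V : Set (Eu d)).indicator f =ᵐ[volume.restrict (U : Set (Eu d))]
      (V : Set (Eu d)).indicator g := by
  rw [← restrict_restrict_opens h] at hfg
  exact (ae_eq_restrict_iff_indicator_ae_eq V.isOpen.measurableSet).1 hfg

/-- Extension by zero `L²(V) → L²(U)`, `V ⊆ U`. -/
def extendL2 {d : ℕ} {U V : Opens (Eu d)} (h : V ≤ U) : L2 V →ₗ[ℂ] L2 U where
  toFun f := (memLp_indicator h f).toLp _
  map_add' f g := by
    rw [← MemLp.toLp_add]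
    refine MemLp.toLp_congr _ _ ?_
    rw [← Set.indicator_add']
    exact indicator_ae_eq h (Lp.coeFn_add f g)
  map_smul' c f := by
    rw [RingHom.id_apply, ← MemLp.toLp_const_smul]
    refine MemLp.toLp_congr _ _ ?_
    have hs : c • (V : Set (Eu d)).indicator f = (V : Set (Eu d)).indicator (c • ⇑f) :=
      (Set.indicator_const_smul _ c f).symm
    rw [hs]
    exact indicator_ae_eq h (Lp.coeFn_smul c f)

theorem coeFn_extendL2 {d : ℕ} {U V : Opens (Eu d)} (h : V ≤ U) (f : L2 V) :
    extendL2 h f =ᵐ[volume.restrict (U : Set (Eu d))] (V : Set (Eu d)).indicator f :=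
  (memLp_indicator h f).coeFn_toLp

theorem continuous_extendL2 {d : ℕ} {U V : Opens (Eu d)} (h : V ≤ U) :
    Continuous (extendL2 h) := by
  refine ((extendL2 h).mkContinuous 1 fun f => ?_).continuous
  rw [one_mul, Lp.norm_def, Lp.norm_def, eLpNorm_congr_ae (coeFn_extendL2 h f),
    eLpNorm_indicator_eq_eLpNorm_restrict V.isOpen.measurableSet, restrict_restrict_opens h]

theorem exists_integral_mul_eq_inner {d : ℕ} {U : Opens (Eu d)} {h : Eu d → ℂ}
    (hh : MemLp h 2 (volume.restrict (U : Set (Eu d)))) :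
    ∃ k : L2 U, ∀ f : L2 U, ∫ x in (U : Set (Eu d)), f x * h x = inner ℂ k f := by
  refine ⟨hh.star.toLp _, fun f => ?_⟩
  rw [L2.inner_def]
  refine integral_congr_ae ?_
  filter_upwards [hh.star.coeFn_toLp] with x hx
  rw [hx]
  simp

namespace NormalizedRootSystem

variable {d : ℕ} {R : NormalizedRootSystem d} {c : Eu d} {Ω : Opens (Eu d)}

theorem IsSymmetric.apply_mem_iff (hΩ : R.IsSymmetric Ω) (g : R.weylGroup) {x : Eu d} :
    g.1 x ∈ Ω ↔ x ∈ Ω := by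
  have h := R.weylGroup_image_eq hΩ g.2
  rw [← SetLike.mem_coe, ← h, g.1.injective.mem_set_image]
  rfl

/-- The pullback `F ↦ F ∘ g` on `L²(Ω)`. -/
abbrev pullback (hΩ : R.IsSymmetric Ω) (g : R.weylGroup) : L2 Ω →ₗ[ℂ] L2 Ω :=
  Lp.compMeasurePreservingₗ ℂ g.1 (hΩ.measurePreserving g)

theorem coeFn_pullback (hΩ : R.IsSymmetric Ω) (g : R.weylGroup) (F : L2 Ω) :
    pullback hΩ g F =ᵐ[volume.restrict (Ω : Set (Eu d))] F ∘ g.1 :=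
  Lp.coeFn_compMeasurePreserving F (hΩ.measurePreserving g)

theorem continuous_pullback (hΩ : R.IsSymmetric Ω) (g : R.weylGroup) :
    Continuous (pullback hΩ g) :=
  (Lp.isometry_compMeasurePreserving (hΩ.measurePreserving g)).continuous

theorem inner_pullback (hΩ : R.IsSymmetric Ω) (g : R.weylGroup) (F G : L2 Ω) :
    inner ℂ (pullback hΩ g F) (pullback hΩ g G) = inner ℂ F G :=
  (Lp.compMeasurePreservingₗᵢ ℂ g.1 (hΩ.measurePreserving g)).inner_map_map F G

theorem pullback_pullback (hΩ : R.IsSymmetric Ω) (g h : R.weylGroup) (F : L2 Ω) :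
    pullback hΩ h (pullback hΩ g F) = pullback hΩ (g * h) F := by
  refine Lp.ext ?_
  filter_upwards [coeFn_pullback hΩ h (pullback hΩ g F), coeFn_pullback hΩ (g * h) F,
    (hΩ.measurePreserving h).quasiMeasurePreserving.ae (coeFn_pullback hΩ g F)] with x h1 h2 h3
  rw [h1, h2, Function.comp_apply, h3]
  rfl

theorem pullback_one (hΩ : R.IsSymmetric Ω) (F : L2 Ω) : pullback hΩ 1 F = F := by
  refine Lp.ext ?_
  filter_upwards [coeFn_pullback hΩ 1 F] with x h1
  rw [h1]
  rfl

theorem average_apply (hΩ : R.IsSymmetric Ω) (ω : R.weylGroup → ℂ) (F : L2 Ω) :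
    average hΩ ω F =
      (Fintype.card R.weylGroup : ℂ)⁻¹ • ∑ g : R.weylGroup, ω g • pullback hΩ g F := by
  simp [average]

/-! ### The tiling of $\Omega$ by the images of $\Omega_+$. -/

theorem ae_inner_root_ne_zero (R : NormalizedRootSystem d) :
    ∀ᵐ x : Eu d, ∀ α ∈ R.roots, inner ℝ x α ≠ 0 := by
  refine (ae_ball_iff R.finite.countable).2 fun α hα => ?_
  have h := Measure.addHaar_submodule (volume : Measure (Eu d)) (ℝ ∙ α)ᗮ fun htop => by
    have hmem : α ∈ (ℝ ∙ α)ᗮ := htop ▸ Submodule.mem_top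
    have h0 := Submodule.mem_orthogonal_singleton_iff_inner_right.1 hmem
    rw [real_inner_self_eq_norm_sq, R.norm_eq_one α hα] at h0
    norm_num at h0
  rw [ae_iff]
  refine measure_mono_null (fun x hx => ?_) h
  exact Submodule.mem_orthogonal_singleton_iff_inner_left.2 (by simpa using hx)

/-- `Ω_+` is a fundamental domain for the action of `W` on `Ω`. -/
theorem integral_eq_sum_integral_posPart (hc : ∀ α ∈ R.roots, inner ℝ α c ≠ 0)
    (hΩ : R.IsSymmetric Ω) {h : Eu d → ℂ} (hh : IntegrableOn h (Ω : Set (Eu d))) :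
    ∫ x in (Ω : Set (Eu d)), h x =
      ∑ g : R.weylGroup, ∫ x in (R.posPart c Ω : Set (Eu d)), h (g.1 x) := by
  have hsub : ∀ g : R.weylGroup, g.1 '' (R.posPart c Ω : Set (Eu d)) ⊆ Ω := by
    rintro g _ ⟨x, hx, rfl⟩
    exact (hΩ.apply_mem_iff g).2 hx.1
  have hU : (⋃ g : R.weylGroup, g.1 '' (R.posPart c Ω : Set (Eu d))) =ᵐ[volume]
      (Ω : Set (Eu d)) := by
    refine (LE.le.eventuallyLE (Set.iUnion_subset hsub)).antisymm ?_
    -- Only points on the root hyperplanes can be missed.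
    filter_upwards [ae_inner_root_ne_zero R] with x hx hxΩ
    obtain ⟨g, hg⟩ := exists_apply_mem_chamber (c := c) hx
    exact Set.mem_iUnion.2 ⟨g⁻¹, g.1 x, ⟨(hΩ.apply_mem_iff g).2 hxΩ, hg⟩,
      g.1.symm_apply_apply x⟩
  have hdisj : Pairwise (Function.onFun Disjoint fun g : R.weylGroup =>
      g.1 '' (R.posPart c Ω : Set (Eu d))) := by
    intro g g' hne
    refine Set.disjoint_left.2 ?_
    rintro _ ⟨x, hx, rfl⟩ ⟨y, hy, hxy⟩
    -- A common point of two tiles gives an element of $W$ that takes one point of $C_+$ to another;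
    -- freeness makes it trivial.
    have h1 : (g'⁻¹ * g).1 x = y := by
      change g'.1.symm (g.1 x) = y
      rw [← hxy, LinearIsometryEquiv.symm_apply_apply]
    have h2 := eq_one_of_apply_mem_chamber hc (g'⁻¹ * g).2 hx.2 (h1 ▸ hy.2)
    exact hne (inv_mul_eq_one.1 (Subtype.ext h2 : g'⁻¹ * g = 1)).symm
  rw [← setIntegral_congr_set hU, integral_iUnion_fintype _ hdisj]
  · refine Finset.sum_congr rfl fun g _ => ?_
    exact g.1.measurePreserving.setIntegral_image_emb g.1.toHomeomorph.measurableEmbedding h _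
  · exact fun g => hh.mono_set (hsub g)
  · intro g
    exact g.1.toHomeomorph.measurableEmbedding.measurableSet_image.2
      (R.posPart c Ω).isOpen.measurableSet

variable (c) in
/-- The restriction operator `L²(Ω) → L²(Ω_+)`. -/
abbrev restrictPos (R : NormalizedRootSystem d) (Ω : Opens (Eu d)) :
    L2 Ω →ₗ[ℂ] L2 (R.posPart c Ω) :=
  restrictL2 (R.posPart_le c Ω)

theorem coeFn_restrictPos_pullback (hΩ : R.IsSymmetric Ω) (g : R.weylGroup) (F : L2 Ω) :
    restrictPos c R Ω (pullback hΩ g F) =ᵐ[volume.restrict (R.posPart c Ω : Set (Eu d))]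
      F ∘ g.1 :=
  (coeFn_restrictL2 _ _).trans
    (ae_mono (Measure.restrict_mono (R.posPart_le c Ω) le_rfl) (coeFn_pullback hΩ g F))

theorem sum_inner_restrictPos_pullback (hc : ∀ α ∈ R.roots, inner ℝ α c ≠ 0)
    (hΩ : R.IsSymmetric Ω) (F G : L2 Ω) :
    ∑ g : R.weylGroup, inner ℂ (restrictPos c R Ω (pullback hΩ g F))
      (restrictPos c R Ω (pullback hΩ g G)) = inner ℂ F G := by
  rw [L2.inner_def F G, integral_eq_sum_integral_posPart hc hΩ (L2.integrable_inner F G)]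
  refine Finset.sum_congr rfl fun g _ => ?_
  rw [L2.inner_def]
  refine integral_congr_ae ?_
  filter_upwards [coeFn_restrictPos_pullback (c := c) hΩ g F,
    coeFn_restrictPos_pullback (c := c) hΩ g G] with x h1 h2
  rw [h1, h2]
  rfl

theorem restrictPos_extendL2 (u : L2 (R.posPart c Ω)) :
    restrictPos c R Ω (extendL2 (R.posPart_le c Ω) u) = u := by
  refine Lp.ext ?_
  filter_upwards [coeFn_restrictL2 (R.posPart_le c Ω) (extendL2 (R.posPart_le c Ω) u),
    ae_mono (Measure.restrict_mono (R.posPart_le c Ω) le_rfl)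
      (coeFn_extendL2 (R.posPart_le c Ω) u),
    ae_restrict_mem (R.posPart c Ω).isOpen.measurableSet] with x h1 h2 h3
  rw [h1, h2, Set.indicator_of_mem h3]

theorem restrictPos_pullback_extendL2 (hc : ∀ α ∈ R.roots, inner ℝ α c ≠ 0)
    (hΩ : R.IsSymmetric Ω) {g : R.weylGroup} (hg : g ≠ 1) (u : L2 (R.posPart c Ω)) :
    restrictPos c R Ω (pullback hΩ g (extendL2 (R.posPart_le c Ω) u)) = 0 := by
  refine Lp.ext ?_
  filter_upwards [coeFn_restrictPos_pullback (c := c) hΩ g (extendL2 (R.posPart_le c Ω) u),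
    ae_mono (Measure.restrict_mono (R.posPart_le c Ω) le_rfl)
      ((hΩ.measurePreserving g).quasiMeasurePreserving.ae (coeFn_extendL2 (R.posPart_le c Ω) u)),
    ae_restrict_mem (R.posPart c Ω).isOpen.measurableSet,
    Lp.coeFn_zero ℂ 2 (volume.restrict (R.posPart c Ω : Set (Eu d)))] with x h1 h2 h3 h4
  rw [h1, Function.comp_apply, h2, h4, Set.indicator_of_notMem]
  · rfl
  · exact fun hmem => hg (Subtype.ext (eq_one_of_apply_mem_chamber hc g.2 h3.2 hmem.2))

/-! ## Averages with respect to sign characters -/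

/-- `ω` is a character of `W` with values in `{1, -1}`. -/
structure IsSignCharacter (ω : R.weylGroup → ℂ) : Prop where
  map_mul : ∀ g h, ω (g * h) = ω g * ω h
  mul_self : ∀ g, ω g * ω g = 1
  conj_eq : ∀ g, conj (ω g) = ω g

namespace IsSignCharacter

variable {ω : R.weylGroup → ℂ}

theorem map_one (hω : IsSignCharacter ω) : ω 1 = 1 := by
  rw [← mul_one (1 : R.weylGroup), hω.map_mul, hω.mul_self]

theorem map_inv (hω : IsSignCharacter ω) (g : R.weylGroup) : ω g⁻¹ = ω g := by
  have h : ω g⁻¹ * ω g = 1 := by rw [← hω.map_mul, inv_mul_cancel, hω.map_one]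
  calc ω g⁻¹ = ω g⁻¹ * (ω g * ω g) := by rw [hω.mul_self, mul_one]
    _ = ω g := by rw [← mul_assoc, h, one_mul]

end IsSignCharacter

variable {ω : R.weylGroup → ℂ}

theorem card_weylGroup_ne_zero (R : NormalizedRootSystem d) :
    (Fintype.card R.weylGroup : ℂ) ≠ 0 :=
  Nat.cast_ne_zero.2 Fintype.card_ne_zero

theorem pullback_average (hω : IsSignCharacter ω) (hΩ : R.IsSymmetric Ω) (h : R.weylGroup)
    (F : L2 Ω) : pullback hΩ h (average hΩ ω F) = ω h • average hΩ ω F := by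
  rw [average_apply, map_smul, map_sum, smul_comm (ω h)]
  refine congrArg _ ?_
  rw [Finset.smul_sum]
  -- Substitution of $gh$ for $g$, with $\omega(g)=\omega(h)\omega(gh)$ because $\omega(h)^2=1$.
  refine Fintype.sum_equiv (Equiv.mulRight h) _ _ fun g => ?_
  rw [map_smul, pullback_pullback, smul_smul, Equiv.coe_mulRight, hω.map_mul, mul_left_comm,
    hω.mul_self, mul_one]

theorem average_eq_self (hω : IsSignCharacter ω) (hΩ : R.IsSymmetric Ω) {F : L2 Ω}
    (hF : ∀ g, pullback hΩ g F = ω g • F) : average hΩ ω F = F := by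
  rw [average_apply]
  simp only [hF, smul_smul, hω.mul_self, one_smul, Finset.sum_const, Finset.card_univ]
  rw [← Nat.cast_smul_eq_nsmul ℂ (Fintype.card R.weylGroup) F, smul_smul,
    inv_mul_cancel₀ (card_weylGroup_ne_zero R), one_smul]

theorem average_average (hω : IsSignCharacter ω) (hΩ : R.IsSymmetric Ω) (F : L2 Ω) :
    average hΩ ω (average hΩ ω F) = average hΩ ω F :=
  average_eq_self hω hΩ fun g => pullback_average hω hΩ g F

/-- The adjoint of the pullback by $g$ is the pullback by $g^{-1}$, and $\omega$ is real with
$\omega(g^{-1})=\omega(g)$. -/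
theorem inner_average_left (hω : IsSignCharacter ω) (hΩ : R.IsSymmetric Ω) (F G : L2 Ω) :
    inner ℂ (average hΩ ω F) G = inner ℂ F (average hΩ ω G) := by
  simp only [average_apply, inner_smul_left, inner_smul_right, sum_inner, inner_sum, hω.conj_eq,
    map_inv₀, map_natCast]
  congr 1
  refine Fintype.sum_equiv (Equiv.inv _) _ _ fun g => ?_
  rw [Equiv.inv_apply, hω.map_inv, ← inner_pullback hΩ g F, pullback_pullback, inv_mul_cancel,
    pullback_one]

/-- Every tile contributes the same amount, since the two factors $\omega(g)$ cancel. -/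
theorem inner_eq_card_mul_inner_restrictPos (hc : ∀ α ∈ R.roots, inner ℝ α c ≠ 0)
    (hω : IsSignCharacter ω) (hΩ : R.IsSymmetric Ω) {F G : L2 Ω}
    (hF : ∀ g, pullback hΩ g F = ω g • F) (hG : ∀ g, pullback hΩ g G = ω g • G) :
    inner ℂ F G =
      Fintype.card R.weylGroup * inner ℂ (restrictPos c R Ω F) (restrictPos c R Ω G) := by
  rw [← sum_inner_restrictPos_pullback hc hΩ F G]
  simp only [hF, hG, map_smul, inner_smul_left, inner_smul_right, hω.conj_eq]
  simp [← mul_assoc, hω.mul_self]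

/-- On $\Omega_+$ only the term $g=1$ of the average survives, and the factor $|W|$ undoes the
normalization. This lifts arbitrary right-hand sides $u$ from $\Omega_+$ to $\Omega$. -/
theorem exists_equivariant_extension (hc : ∀ α ∈ R.roots, inner ℝ α c ≠ 0)
    (hω : IsSignCharacter ω) (hΩ : R.IsSymmetric Ω) (u : L2 (R.posPart c Ω)) :
    averagePos c hΩ ω ((Fintype.card R.weylGroup : ℂ) • extendL2 (R.posPart_le c Ω) u) = u := by
  rw [averagePos, LinearMap.comp_apply, average_apply]
  simp only [map_smul, map_sum]
  rw [Finset.sum_eq_single 1 _ (by simp), hω.map_one, pullback_one, one_smul, restrictPos_extendL2,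
    smul_smul, inv_mul_cancel₀ (card_weylGroup_ne_zero R), one_smul]
  intro g _ hg
  rw [restrictPos_pullback_extendL2 hc hΩ hg, smul_zero, smul_zero]

end NormalizedRootSystem

/-! ## Test functions -/

section TestFunction

variable {d : ℕ} {U V : Opens (Eu d)}

theorem testFunction_eq_zero (φ : 𝓓(U, ℂ)) {x : Eu d} (hx : x ∉ U) : φ x = 0 :=
  image_eq_zero_of_notMem_tsupport fun h => hx (φ.tsupport_subset h)

theorem partialDeriv_testFunction_eq_zero (j : Fin d) (φ : 𝓓(U, ℂ)) {x : Eu d} (hx : x ∉ U) :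
    partialDeriv j φ x = 0 := by
  rw [partialDeriv, fderiv_of_notMem_tsupport ℝ fun h => hx (φ.tsupport_subset h)]
  rfl

theorem differentiable_testFunction (φ : 𝓓(U, ℂ)) : Differentiable ℝ φ :=
  φ.contDiff.differentiable (by simp)

theorem continuous_partialDeriv (j : Fin d) (φ : 𝓓(U, ℂ)) : Continuous (partialDeriv j φ) :=
  (φ.contDiff.continuous_fderiv (by simp)).clm_apply continuous_const

/-- A test function on `V`, regarded as a test function on `U ⊇ V`. -/
def testExtend (h : V ≤ U) (φ : 𝓓(V, ℂ)) : 𝓓(U, ℂ) :=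
  ⟨φ, φ.contDiff, φ.hasCompactSupport, φ.tsupport_subset.trans h⟩

/-- The class in `L²(U)` of a test function. -/
def testL2 (φ : 𝓓(U, ℂ)) : L2 U := (memLp_testFunction φ).toLp φ

/-- The class in `L²(U)` of a partial derivative of a test function. -/
def testPartialL2 (j : Fin d) (φ : 𝓓(U, ℂ)) : L2 U :=
  (memLp_partialDeriv j φ).toLp (partialDeriv j φ)

theorem coeFn_testL2 (φ : 𝓓(U, ℂ)) : testL2 φ =ᵐ[volume.restrict (U : Set (Eu d))] φ :=
  (memLp_testFunction φ).coeFn_toLp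

theorem coeFn_testPartialL2 (j : Fin d) (φ : 𝓓(U, ℂ)) :
    testPartialL2 j φ =ᵐ[volume.restrict (U : Set (Eu d))] partialDeriv j φ :=
  (memLp_partialDeriv j φ).coeFn_toLp

/-- The classical derivatives of a test function are its weak derivatives. -/
theorem hasWeakPartial_testL2 (j : Fin d) (φ : 𝓓(U, ℂ)) :
    HasWeakPartial U j (testL2 φ) (testPartialL2 j φ) := by
  intro ψ
  have h1 : ∫ x in (U : Set (Eu d)), testL2 φ x * partialDeriv j ψ x =
      ∫ x, φ x * partialDeriv j ψ x := by
    rw [← setIntegral_eq_integral_of_forall_compl_eq_zero (s := (U : Set (Eu d)))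
      (f := fun x => φ x * partialDeriv j ψ x)
      fun x hx => by rw [testFunction_eq_zero φ hx, zero_mul]]
    refine integral_congr_ae ?_
    filter_upwards [coeFn_testL2 φ] with x hx
    rw [hx]
  have h2 : ∫ x in (U : Set (Eu d)), testPartialL2 j φ x * ψ x =
      ∫ x, partialDeriv j φ x * ψ x := by
    rw [← setIntegral_eq_integral_of_forall_compl_eq_zero (s := (U : Set (Eu d)))
      (f := fun x => partialDeriv j φ x * ψ x)
      fun x hx => by rw [testFunction_eq_zero ψ hx, mul_zero]]
    refine integral_congr_ae ?_
    filter_upwards [coeFn_testPartialL2 j φ] with x hx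
    rw [hx]
  rw [h1, h2]
  refine integral_mul_fderiv_eq_neg_fderiv_mul_of_integrable ?_ ?_ ?_
    (fun x _ => differentiable_testFunction φ x) (fun x _ => differentiable_testFunction ψ x)
  · exact ((continuous_partialDeriv j φ).mul ψ.continuous).integrable_of_hasCompactSupport
      ψ.hasCompactSupport.mul_left
  · exact (φ.continuous.mul (continuous_partialDeriv j ψ)).integrable_of_hasCompactSupport
      φ.hasCompactSupport.mul_right
  · exact (φ.continuous.mul ψ.continuous).integrable_of_hasCompactSupport
      ψ.hasCompactSupport.mul_left

/-- Test functions are dense in `L²(U)`. -/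
theorem eq_zero_of_inner_testL2_eq_zero {u : L2 U} (hu : ∀ φ : 𝓓(U, ℂ), inner ℂ (testL2 φ) u = 0) :
    u = 0 := by
  have hloc : LocallyIntegrableOn u (U : Set (Eu d)) volume :=
    locallyIntegrableOn_of_locallyIntegrable_restrict
      ((Lp.memLp u).locallyIntegrable (by norm_num))
  have hae := U.isOpen.ae_eq_zero_of_integral_contDiff_smul_eq_zero hloc (by
    intro g hg hgc hgs
    let φ : 𝓓(U, ℂ) :=
      ⟨fun x => (g x : ℂ), Complex.ofRealCLM.contDiff.comp hg,
        hgc.comp_left (g := fun r : ℝ => (r : ℂ)) (by simp),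
        (closure_mono (fun x hx => by
          simpa using hx)).trans hgs⟩
    rw [← setIntegral_eq_integral_of_forall_compl_eq_zero (s := (U : Set (Eu d)))
      (fun x hx => by
        have : g x = 0 := by
          by_contra hne
          exact hx (hgs (subset_tsupport g hne))
        simp [this]), ← hu φ, L2.inner_def]
    refine integral_congr_ae ?_
    filter_upwards [coeFn_testL2 φ] with x hx
    rw [hx]
    change g x • u x = u x * conj (g x : ℂ)
    rw [Complex.conj_ofReal, Complex.real_smul, mul_comm])
  rw [Lp.eq_zero_iff_ae_eq_zero]
  exact (ae_restrict_iff' U.isOpen.measurableSet).2 hae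

end TestFunction

/-! ## Weak derivatives of restrictions and pullbacks -/

theorem weakPartial_eq {d : ℕ} {U : Opens (Eu d)} {j : Fin d} {f : H1 U} {v : L2 U}
    (h : HasWeakPartial U j f v) : weakPartial U j f = v :=
  (weakPartial_spec U j f).unique h

theorem HasWeakPartial.restrictL2 {d : ℕ} {U V : Opens (Eu d)} (h : V ≤ U) {j : Fin d}
    {f v : L2 U} (hf : HasWeakPartial U j f v) :
    HasWeakPartial V j (restrictL2 h f) (restrictL2 h v) := by
  intro φ
  have key : ∀ (f : L2 U) (k : Eu d → ℂ), (∀ x ∉ V, k x = 0) →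
      ∫ x in (V : Set (Eu d)), ReflectionLaplacian.restrictL2 h f x * k x =
        ∫ x in (U : Set (Eu d)), f x * k x := by
    intro f k hk
    rw [setIntegral_eq_of_subset_of_forall_sdiff_eq_zero (s := (V : Set (Eu d)))
      U.isOpen.measurableSet h fun x hx => by rw [hk x hx.2, mul_zero]]
    refine integral_congr_ae ?_
    filter_upwards [coeFn_restrictL2 h f] with x hx
    rw [hx]
  rw [key _ _ fun x hx => partialDeriv_testFunction_eq_zero j φ hx,
    key _ _ fun x hx => testFunction_eq_zero φ hx]
  exact hf (testExtend h φ)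

/-- The restriction operator `H¹(U) → H¹(V)`. -/
def restrictH1 {d : ℕ} {U V : Opens (Eu d)} (h : V ≤ U) : H1 U →ₗ[ℂ] H1 V :=
  (restrictL2 h).restrict fun f hf j => by
    obtain ⟨v, hv⟩ := hf j
    exact ⟨_, hv.restrictL2 h⟩

theorem coe_restrictH1 {d : ℕ} {U V : Opens (Eu d)} (h : V ≤ U) (f : H1 U) :
    (restrictH1 h f : L2 V) = restrictL2 h f := rfl

theorem weakPartial_restrictH1 {d : ℕ} {U V : Opens (Eu d)} (h : V ≤ U) (j : Fin d) (f : H1 U) :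
    weakPartial V j (restrictH1 h f) = restrictL2 h (weakPartial U j f) :=
  weakPartial_eq ((weakPartial_spec U j f).restrictL2 h)

theorem single_eq_sum {d : ℕ} (x : Eu d) : x = ∑ i, x i • EuclideanSpace.single i (1 : ℝ) := by
  have := (EuclideanSpace.basisFun (Fin d) ℝ).sum_repr x
  simpa using this.symm

/-- The chain rule for partial derivatives under a linear isometry. -/
theorem partialDeriv_comp_isometry {d : ℕ} (g : Eu d ≃ₗᵢ[ℝ] Eu d) {φ : Eu d → ℂ}
    (hφ : Differentiable ℝ φ) (j : Fin d) (x : Eu d) :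
    partialDeriv j (φ ∘ g) x =
      ∑ i, ((g (EuclideanSpace.single j 1) i : ℝ) : ℂ) * partialDeriv i φ (g x) := by
  have h : HasFDerivAt (φ ∘ g)
      ((fderiv ℝ φ (g x)).comp (g.toContinuousLinearEquiv : Eu d →L[ℝ] Eu d)) x :=
    (hφ (g x)).hasFDerivAt.comp x g.toContinuousLinearEquiv.hasFDerivAt
  rw [partialDeriv, h.fderiv, ContinuousLinearMap.comp_apply]
  change fderiv ℝ φ (g x) (g (EuclideanSpace.single j 1)) = _
  conv_lhs => rw [single_eq_sum (g (EuclideanSpace.single j 1)), map_sum]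
  simp only [map_smul, Complex.real_smul, partialDeriv]

/-- Orthogonal substitutions do not change the sum of the inner products of the components. -/
theorem sum_inner_sum_isometry {d : ℕ} {H : Type*} [NormedAddCommGroup H] [InnerProductSpace ℂ H]
    (g : Eu d ≃ₗᵢ[ℝ] Eu d) (x y : Fin d → H) :
    ∑ j, inner ℂ (∑ i, ((g (EuclideanSpace.single j 1) i : ℝ) : ℂ) • x i)
      (∑ i, ((g (EuclideanSpace.single j 1) i : ℝ) : ℂ) • y i) = ∑ i, inner ℂ (x i) (y i) := by
  have h : ∀ i k : Fin d, ∑ j, g (EuclideanSpace.single j 1) i * g (EuclideanSpace.single j 1) k =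
      if i = k then 1 else 0 := by
    intro i k
    have := ((EuclideanSpace.basisFun (Fin d) ℝ).map g).sum_inner_mul_inner
      (EuclideanSpace.single i 1) (EuclideanSpace.single k 1)
    simpa [EuclideanSpace.inner_single_left, EuclideanSpace.inner_single_right, Pi.single_apply,
      eq_comm] using this
  simp only [sum_inner, inner_sum, inner_smul_left, inner_smul_right, Complex.conj_ofReal]
  rw [Finset.sum_comm]
  refine Finset.sum_congr rfl fun i _ => ?_
  simp only [Finset.mul_sum, ← mul_assoc]
  rw [Finset.sum_comm]
  have h2 : ∀ k, ∑ j, ((g (EuclideanSpace.single j 1) i : ℝ) : ℂ) *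
      ((g (EuclideanSpace.single j 1) k : ℝ) : ℂ) = if i = k then 1 else 0 := by
    intro k
    have := congrArg (fun r : ℝ => (r : ℂ)) (h i k)
    push_cast at this
    rw [this]
    split_ifs <;> simp
  simp [← Finset.sum_mul, h2]

namespace NormalizedRootSystem

variable {d : ℕ} {R : NormalizedRootSystem d} {c : Eu d} {Ω : Opens (Eu d)}

/-- The pullback of a test function. -/
def testPullback (hΩ : R.IsSymmetric Ω) (g : R.weylGroup) (φ : 𝓓(Ω, ℂ)) : 𝓓(Ω, ℂ) :=
  ⟨φ ∘ g.1, φ.contDiff.comp g.1.contDiff,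
    φ.hasCompactSupport.comp_homeomorph g.1.toHomeomorph, by
      have h : tsupport (φ ∘ g.1) ⊆ g.1 ⁻¹' tsupport φ :=
        closure_minimal (fun x hx => subset_tsupport φ hx)
          ((isClosed_tsupport φ).preimage g.1.continuous)
      exact fun x hx => (hΩ.apply_mem_iff g).1 (φ.tsupport_subset (h hx))⟩

theorem coe_testPullback (hΩ : R.IsSymmetric Ω) (g : R.weylGroup) (φ : 𝓓(Ω, ℂ)) :
    ⇑(testPullback hΩ g φ) = φ ∘ g.1 := rfl

/-- The matrix of the Weyl group element `g`. -/
def weylCoeff (g : R.weylGroup) (j i : Fin d) : ℂ :=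
  ((g.1 (EuclideanSpace.single j 1) i : ℝ) : ℂ)

theorem integral_pullback_mul (hΩ : R.IsSymmetric Ω) (g : R.weylGroup) (F : L2 Ω)
    (k : Eu d → ℂ) :
    ∫ x in (Ω : Set (Eu d)), pullback hΩ g F x * k (g.1 x) =
      ∫ x in (Ω : Set (Eu d)), F x * k x := by
  rw [← (hΩ.measurePreserving g).integral_comp g.1.toHomeomorph.measurableEmbedding
    fun x => F x * k x]
  refine integral_congr_ae ?_
  filter_upwards [coeFn_pullback hΩ g F] with x hx
  rw [hx]
  rfl

/-- The test function is written as $\psi\circ g$, and the substitution $y=gx$ moves the weak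
identity to $F$ and $\psi$; the chain rule for $\psi\circ g$ supplies the coefficients. -/
theorem hasWeakPartial_pullback (hΩ : R.IsSymmetric Ω) (g : R.weylGroup) {F : L2 Ω}
    {v : Fin d → L2 Ω} (h : ∀ i, HasWeakPartial Ω i F (v i)) (j : Fin d) :
    HasWeakPartial Ω j (pullback hΩ g F) (∑ i, weylCoeff g j i • pullback hΩ g (v i)) := by
  intro φ
  set ψ := testPullback hΩ g⁻¹ φ
  have hψ : ⇑φ = ψ ∘ g.1 := by
    funext x
    exact congrArg φ (g.1.symm_apply_apply x).symm
  have h1 : ∀ x, partialDeriv j φ x = ∑ i, weylCoeff g j i * partialDeriv i ψ (g.1 x) := by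
    intro x
    rw [hψ, partialDeriv_comp_isometry g.1 (differentiable_testFunction ψ)]
    rfl
  have h2 : ∫ x in (Ω : Set (Eu d)), pullback hΩ g F x * partialDeriv j φ x =
      ∑ i, weylCoeff g j i * ∫ x in (Ω : Set (Eu d)), F x * partialDeriv i ψ x := by
    simp only [h1]
    rw [integral_pullback_mul hΩ g F fun y => ∑ i, weylCoeff g j i * partialDeriv i ψ y]
    simp only [Finset.mul_sum, mul_left_comm _ (weylCoeff g j _)]
    rw [integral_finsetSum _ fun i _ =>
      (integrable_L2_mul F (memLp_partialDeriv i ψ)).const_mul _]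
    simp only [integral_const_mul]
  -- The integral against $\varphi$ is written as an inner product, which is additive on the sum of
  -- $L^2$ classes.
  obtain ⟨k, hk⟩ := exists_integral_mul_eq_inner (memLp_testFunction φ)
  rw [h2, hk, inner_sum, ← Finset.sum_neg_distrib]
  refine Finset.sum_congr rfl fun i _ => ?_
  rw [inner_smul_right, ← hk, h i ψ, hψ]
  have := integral_pullback_mul hΩ g (v i) ψ
  rw [← this, mul_neg]
  rfl

/-- The pullback `F ↦ F ∘ g` on `H¹(Ω)`. -/
def pullbackH1 (hΩ : R.IsSymmetric Ω) (g : R.weylGroup) : H1 Ω →ₗ[ℂ] H1 Ω :=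
  (pullback hΩ g).restrict fun f hf j => by
    choose v hv using hf
    exact ⟨_, hasWeakPartial_pullback hΩ g hv j⟩

theorem coe_pullbackH1 (hΩ : R.IsSymmetric Ω) (g : R.weylGroup) (F : H1 Ω) :
    (pullbackH1 hΩ g F : L2 Ω) = pullback hΩ g F := rfl

theorem weakPartial_pullbackH1 (hΩ : R.IsSymmetric Ω) (g : R.weylGroup) (j : Fin d) (F : H1 Ω) :
    weakPartial Ω j (pullbackH1 hΩ g F) =
      ∑ i, weylCoeff g j i • pullback hΩ g (weakPartial Ω i F) :=
  weakPartial_eq (hasWeakPartial_pullback hΩ g (fun i => weakPartial_spec Ω i F) j)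

/-! ### Invariance of the gradient form under $W$ and its splitting over the tiles. -/

theorem gradForm_apply (U : Opens (Eu d)) (f g : H1 U) :
    gradForm U f g = ∑ j, inner ℂ (weakPartial U j g) (weakPartial U j f) := rfl

theorem gradForm_pullbackH1 (hΩ : R.IsSymmetric Ω) (g : R.weylGroup) (F G : H1 Ω) :
    gradForm Ω (pullbackH1 hΩ g F) (pullbackH1 hΩ g G) = gradForm Ω F G := by
  simp only [gradForm_apply, weakPartial_pullbackH1]
  refine (sum_inner_sum_isometry g.1 _ _).trans ?_
  simp only [inner_pullback]

variable (c) in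
/-- The restriction operator `H¹(Ω) → H¹(Ω_+)`. -/
abbrev restrictPosH1 (R : NormalizedRootSystem d) (Ω : Opens (Eu d)) :
    H1 Ω →ₗ[ℂ] H1 (R.posPart c Ω) :=
  restrictH1 (R.posPart_le c Ω)

theorem sum_gradForm_restrictPosH1_pullbackH1 (hc : ∀ α ∈ R.roots, inner ℝ α c ≠ 0)
    (hΩ : R.IsSymmetric Ω) (F G : H1 Ω) :
    ∑ g : R.weylGroup, gradForm (R.posPart c Ω) (restrictPosH1 c R Ω (pullbackH1 hΩ g F))
      (restrictPosH1 c R Ω (pullbackH1 hΩ g G)) = gradForm Ω F G := by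
  have h : ∀ g : R.weylGroup,
      gradForm (R.posPart c Ω) (restrictPosH1 c R Ω (pullbackH1 hΩ g F))
        (restrictPosH1 c R Ω (pullbackH1 hΩ g G)) =
      ∑ i, inner ℂ (restrictPos c R Ω (pullback hΩ g (weakPartial Ω i G)))
        (restrictPos c R Ω (pullback hΩ g (weakPartial Ω i F))) := by
    intro g
    simp only [gradForm_apply, weakPartial_restrictH1, weakPartial_pullbackH1, map_sum, map_smul]
    exact sum_inner_sum_isometry g.1 _ _
  simp only [h]
  rw [Finset.sum_comm]
  simp only [sum_inner_restrictPos_pullback hc hΩ]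
  rfl

end NormalizedRootSystem

/-! ## Operators associated with averaged form domains -/

theorem dense_map_subtype {H : Type*} [NormedAddCommGroup H] [InnerProductSpace ℂ H]
    [CompleteSpace H] {K : Submodule ℂ H} {D : Submodule ℂ K}
    (hD : ∀ u : H, (∀ h ∈ D, inner ℂ (h : H) u = 0) → u = 0) :
    Dense (D.map K.subtype : Set H) := by
  rw [Submodule.dense_iff_topologicalClosure_eq_top, Submodule.topologicalClosure_eq_top_iff,
    Submodule.eq_bot_iff]
  exact fun u hu => hD u fun h hh => hu _ (Submodule.mem_map_of_mem hh)

theorem exists_formOperator_eq {H : Type*} [NormedAddCommGroup H] [InnerProductSpace ℂ H]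
    {K : Submodule ℂ H} {t : K →ₗ[ℂ] K →ₗ⋆[ℂ] ℂ} {D : Submodule ℂ K}
    (hD : Dense (D.map K.subtype : Set H)) {x u : H} (h : (x, u) ∈ formGraph K t D) :
    ∃ hx : x ∈ (formOperator K t D).domain, formOperator K t D ⟨x, hx⟩ = u := by
  rw [← graph_formOperator K t D hD] at h
  obtain ⟨y, rfl, hy⟩ := (LinearPMap.mem_graph_iff _).1 h
  exact ⟨y.2, hy⟩

theorem mem_formGraph_apply {H : Type*} [NormedAddCommGroup H] [InnerProductSpace ℂ H]
    {K : Submodule ℂ H} {t : K →ₗ[ℂ] K →ₗ⋆[ℂ] ℂ} {D : Submodule ℂ K}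
    (hD : Dense (D.map K.subtype : Set H)) (x : (formOperator K t D).domain) :
    ((x : H), formOperator K t D x) ∈ formGraph K t D := by
  rw [← graph_formOperator K t D hD]
  exact LinearPMap.mem_graph _ x

namespace NormalizedRootSystem

variable {d : ℕ} {R : NormalizedRootSystem d} {c : Eu d} {Ω : Opens (Eu d)}
  {ω : R.weylGroup → ℂ}

/-- The averaging operator on `H¹(Ω)`. -/
def averageH1 (hΩ : R.IsSymmetric Ω) (ω : R.weylGroup → ℂ) : H1 Ω →ₗ[ℂ] H1 Ω :=
  (Fintype.card R.weylGroup : ℂ)⁻¹ • ∑ g : R.weylGroup, ω g • pullbackH1 hΩ g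

theorem averageH1_apply (hΩ : R.IsSymmetric Ω) (ω : R.weylGroup → ℂ) (F : H1 Ω) :
    averageH1 hΩ ω F =
      (Fintype.card R.weylGroup : ℂ)⁻¹ • ∑ g : R.weylGroup, ω g • pullbackH1 hΩ g F := by
  simp [averageH1]

theorem coe_averageH1 (hΩ : R.IsSymmetric Ω) (ω : R.weylGroup → ℂ) (F : H1 Ω) :
    (averageH1 hΩ ω F : L2 Ω) = average hΩ ω F := by
  rw [averageH1_apply, average_apply]
  simp [coe_pullbackH1]

theorem pullbackH1_averageH1 (hω : IsSignCharacter ω) (hΩ : R.IsSymmetric Ω) (g : R.weylGroup)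
    (F : H1 Ω) : pullbackH1 hΩ g (averageH1 hΩ ω F) = ω g • averageH1 hΩ ω F := by
  refine Subtype.ext ?_
  rw [coe_pullbackH1, Submodule.coe_smul, coe_averageH1, pullback_average hω]

theorem averageH1_averageH1 (hω : IsSignCharacter ω) (hΩ : R.IsSymmetric Ω) (F : H1 Ω) :
    averageH1 hΩ ω (averageH1 hΩ ω F) = averageH1 hΩ ω F := by
  refine Subtype.ext ?_
  rw [coe_averageH1, coe_averageH1, average_average hω]

theorem gradForm_averageH1_left (hω : IsSignCharacter ω) (hΩ : R.IsSymmetric Ω) (F G : H1 Ω) :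
    gradForm Ω (averageH1 hΩ ω F) G = gradForm Ω F (averageH1 hΩ ω G) := by
  rw [averageH1_apply, averageH1_apply]
  simp only [map_smul, map_sum, LinearMap.smul_apply, LinearMap.sum_apply, map_smulₛₗ,
    hω.conj_eq, map_inv₀, map_natCast]
  congr 1
  refine Fintype.sum_equiv (Equiv.inv _) _ _ fun g => ?_
  rw [Equiv.inv_apply, hω.map_inv, ← gradForm_pullbackH1 hΩ g F]
  congr 2
  refine Subtype.ext ?_
  rw [coe_pullbackH1, coe_pullbackH1, pullback_pullback, inv_mul_cancel, pullback_one]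

theorem gradForm_averageH1_averageH1 (hc : ∀ α ∈ R.roots, inner ℝ α c ≠ 0)
    (hω : IsSignCharacter ω) (hΩ : R.IsSymmetric Ω) (F G : H1 Ω) :
    gradForm Ω (averageH1 hΩ ω F) (averageH1 hΩ ω G) = Fintype.card R.weylGroup *
      gradForm (R.posPart c Ω) (restrictPosH1 c R Ω (averageH1 hΩ ω F))
        (restrictPosH1 c R Ω (averageH1 hΩ ω G)) := by
  rw [← sum_gradForm_restrictPosH1_pullbackH1 hc hΩ]
  simp only [pullbackH1_averageH1 hω, map_smul, LinearMap.smul_apply, map_smulₛₗ, hω.conj_eq,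
    smul_smul, hω.mul_self, one_smul]
  simp

theorem coe_restrictPosH1_averageH1 (hΩ : R.IsSymmetric Ω) (F : H1 Ω) :
    (restrictPosH1 c R Ω (averageH1 hΩ ω F) : L2 (R.posPart c Ω)) = averagePos c hΩ ω F := by
  rw [coe_restrictH1, coe_averageH1]
  rfl

/-- The operator associated with the gradient form on an averaged form domain is the averaged
operator. -/
theorem formOperator_averagePos (hc : ∀ α ∈ R.roots, inner ℝ α c ≠ 0) (hω : IsSignCharacter ω)
    (hΩ : R.IsSymmetric Ω) {D : Submodule ℂ (H1 Ω)} {D' : Submodule ℂ (H1 (R.posPart c Ω))}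
    (hinv : ∀ F ∈ D, averageH1 hΩ ω F ∈ D)
    (hD' : ∀ f : H1 (R.posPart c Ω),
      f ∈ D' ↔ ∃ F ∈ D, averagePos c hΩ ω F = (f : L2 (R.posPart c Ω)))
    (hdense : ∀ u : L2 Ω, (∀ F ∈ D, inner ℂ (F : L2 Ω) u = 0) → u = 0) :
    (formOperator (H1 (R.posPart c Ω)) (gradForm (R.posPart c Ω)) D').domain =
        (formOperator (H1 Ω) (gradForm Ω) D).domain.map (averagePos c hΩ ω) ∧
      ∀ F : (formOperator (H1 Ω) (gradForm Ω) D).domain,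
        ∃ h : averagePos c hΩ ω F ∈
            (formOperator (H1 (R.posPart c Ω)) (gradForm (R.posPart c Ω)) D').domain,
          formOperator (H1 (R.posPart c Ω)) (gradForm (R.posPart c Ω)) D' ⟨_, h⟩ =
            averagePos c hΩ ω (formOperator (H1 Ω) (gradForm Ω) D F) := by
  have hcard := card_weylGroup_ne_zero R
  have hmem : ∀ F ∈ D, restrictPosH1 c R Ω (averageH1 hΩ ω F) ∈ D' := fun F hF =>
    (hD' _).2 ⟨F, hF, (coe_restrictPosH1_averageH1 hΩ F).symm⟩
  have hexists : ∀ f ∈ D', ∃ F ∈ D, restrictPosH1 c R Ω (averageH1 hΩ ω F) = f := by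
    intro f hf
    obtain ⟨F, hF, h⟩ := (hD' f).1 hf
    exact ⟨F, hF, Subtype.ext ((coe_restrictPosH1_averageH1 hΩ F).trans h)⟩
  have hinner : ∀ F G : L2 Ω, inner ℂ (average hΩ ω F) (average hΩ ω G) =
      Fintype.card R.weylGroup * inner ℂ (averagePos c hΩ ω F) (averagePos c hΩ ω G) := fun F G =>
    inner_eq_card_mul_inner_restrictPos hc hω hΩ (fun g => pullback_average hω hΩ g F)
      fun g => pullback_average hω hΩ g G
  have hgraph : ∀ x u : L2 Ω, (x, u) ∈ formGraph (H1 Ω) (gradForm Ω) D →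
      (averagePos c hΩ ω x, averagePos c hΩ ω u) ∈
        formGraph (H1 (R.posPart c Ω)) (gradForm (R.posPart c Ω)) D' := by
    rintro _ u ⟨F, hF, rfl, ht⟩
    refine ⟨_, hmem F hF, coe_restrictPosH1_averageH1 hΩ F, fun f hf => ?_⟩
    obtain ⟨G, hG, rfl⟩ := hexists f hf
    -- After multiplication by $|W|$ both pairings are taken over $\Omega$. There the average is
    -- moved entirely onto the test element $G$, which stays in $D$, so the weak equation for $F$
    -- applies.
    refine mul_left_cancel₀ hcard ?_
    rw [← gradForm_averageH1_averageH1 hc hω, gradForm_averageH1_left hω, averageH1_averageH1 hω,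
      ht _ (hinv G hG), coe_restrictPosH1_averageH1, ← hinner, ← inner_average_left hω,
      average_average hω, coe_averageH1]
  have hgraph' : ∀ f u : L2 (R.posPart c Ω),
      (f, u) ∈ formGraph (H1 (R.posPart c Ω)) (gradForm (R.posPart c Ω)) D' →
        ∃ x U : L2 Ω, (x, U) ∈ formGraph (H1 Ω) (gradForm Ω) D ∧ averagePos c hΩ ω x = f := by
    rintro _ u ⟨f, hf, rfl, ht⟩
    obtain ⟨F, hF, rfl⟩ := hexists f hf
    have hu := exists_equivariant_extension hc hω hΩ u
    set U := (Fintype.card R.weylGroup : ℂ) • extendL2 (R.posPart_le c Ω) u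
    -- Against equivariant data only the average of $G$ counts, so the equation on $\Omega_+$ gives
    -- the equation on $\Omega$ for every $G\in D$.
    refine ⟨averageH1 hΩ ω F, average hΩ ω U, ⟨_, hinv F hF, rfl, fun G hG => ?_⟩, ?_⟩
    · rw [← averageH1_averageH1 hω, gradForm_averageH1_left hω,
        gradForm_averageH1_averageH1 hc hω, ht _ (hmem G hG), coe_restrictPosH1_averageH1,
        ← average_average hω, ← inner_average_left hω, hinner, hu]
    · rw [← coe_restrictPosH1_averageH1, averageH1_averageH1 hω]
  have hd := dense_map_subtype hdense
  have hd' : Dense (D'.map (H1 (R.posPart c Ω)).subtype : Set (L2 (R.posPart c Ω))) := by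
    refine dense_map_subtype fun u hu0 => ?_
    have hu := exists_equivariant_extension hc hω hΩ u
    set U := (Fintype.card R.weylGroup : ℂ) • extendL2 (R.posPart_le c Ω) u
    -- Orthogonality of $u$ to $D'$ lifts to orthogonality of $\mathcal A_\omega U$ to $D$.
    have h0 : average hΩ ω U = 0 := hdense _ fun F hF => by
      have := hu0 _ (hmem F hF)
      rw [coe_restrictPosH1_averageH1] at this
      rw [← average_average hω, ← inner_average_left hω, hinner, hu, this, mul_zero]
    rw [← hu, averagePos, LinearMap.comp_apply, h0, map_zero]
  refine ⟨le_antisymm ?_ ?_, fun F => ?_⟩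
  · intro f hf
    obtain ⟨x, U, hx, rfl⟩ := hgraph' _ _ (mem_formGraph_apply hd' ⟨f, hf⟩)
    exact Submodule.mem_map_of_mem (exists_formOperator_eq hd hx).1
  · rintro _ ⟨x, hx, rfl⟩
    exact (exists_formOperator_eq hd' (hgraph _ _ (mem_formGraph_apply hd ⟨x, hx⟩))).1
  · exact exists_formOperator_eq hd' (hgraph _ _ (mem_formGraph_apply hd F))

theorem isSignCharacter_homWeight (η : R.weylGroup →* ℤˣ) : IsSignCharacter (homWeight η) where
  map_mul g h := by simp [homWeight]
  mul_self g := by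
    rw [homWeight, ← Int.cast_mul, Int.units_coe_mul_self, Int.cast_one]
  conj_eq g := by simp [homWeight]

end NormalizedRootSystem

/-! ## Truncation near zero -/

/-- Dominated convergence in `L²`. -/
theorem tendsto_toLp_of_dominated {X : Type*} [MeasurableSpace X] {μ : Measure X}
    {f : ℕ → X → ℂ} {g : X → ℂ} (hf : ∀ n, MemLp (f n) 2 μ) (hg : MemLp g 2 μ) {b : X → ℂ}
    (hb : MemLp b 2 μ) (hle : ∀ n, ∀ᵐ x ∂μ, ‖f n x‖ ≤ ‖b x‖)
    (hlim : ∀ᵐ x ∂μ, Tendsto (fun n => f n x) atTop (𝓝 (g x))) :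
    Tendsto (fun n => (hf n).toLp) atTop (𝓝 hg.toLp) := by
  rw [Lp.tendsto_Lp_iff_tendsto_eLpNorm'' _ hf g hg]
  simp only [eLpNorm_eq_lintegral_rpow_enorm_toReal (p := 2) two_ne_zero ENNReal.ofNat_ne_top]
  -- The limit $g$ inherits the bound $\|b\|$, whence $\|f_n-g\|\le2\|b\|$.
  have hb2 : MemLp (fun x => (2 : ℂ) * b x) 2 μ := hb.const_mul 2
  have h := tendsto_lintegral_of_dominated_convergence' (μ := μ)
    (F := fun n x => ‖(f n - g) x‖ₑ ^ (2 : ENNReal).toReal) (f := fun _ => 0)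
    (fun x => ‖(2 : ℂ) * b x‖ₑ ^ (2 : ENNReal).toReal)
    (fun n => (((hf n).sub hg).1.enorm).pow_const _) ?_
    (lintegral_rpow_enorm_lt_top_of_eLpNorm_lt_top two_ne_zero ENNReal.ofNat_ne_top hb2.2).ne ?_
  · have h2 := (ENNReal.continuous_rpow_const (y := 1 / (2 : ENNReal).toReal)).tendsto _ |>.comp h
    simpa [Function.comp_def] using h2
  · intro n
    filter_upwards [hle n, ae_all_iff.2 hle, hlim] with x h1 h2 h3
    have hgb : ‖g x‖ ≤ ‖b x‖ := le_of_tendsto' h3.norm h2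
    refine ENNReal.rpow_le_rpow (enorm_le_iff_norm_le.2 ?_) (by simp)
    calc ‖(f n - g) x‖ ≤ ‖f n x‖ + ‖g x‖ := norm_sub_le _ _
      _ ≤ ‖b x‖ + ‖b x‖ := add_le_add h1 hgb
      _ = ‖2 * b x‖ := by rw [norm_mul]; norm_num; ring
  · filter_upwards [hlim] with x h3
    have h4 : Tendsto (fun n => f n x - g x) atTop (𝓝 0) := by
      simpa using h3.sub_const (g x)
    have h5 := (ENNReal.continuous_rpow_const (y := (2 : ENNReal).toReal)).tendsto _ |>.comp
      h4.enorm
    simpa [Function.comp_def] using h5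

/-- The partial derivatives of a `C¹` function vanish almost everywhere on its zero set. -/
theorem ae_partialDeriv_eq_zero_of_eq_zero {d : ℕ} {ψ : Eu d → ℂ} (hψ : ContDiff ℝ 1 ψ)
    (j : Fin d) : ∀ᵐ x : Eu d, ψ x = 0 → partialDeriv j ψ x = 0 := by
  have hcont : Continuous (partialDeriv j ψ) :=
    (hψ.continuous_fderiv (by simp)).clm_apply continuous_const
  have hdiff : Differentiable ℝ ψ := hψ.differentiable (by simp)
  have hmeas : MeasurableSet {x : Eu d | ψ x = 0 → partialDeriv j ψ x = 0} :=
    (measurableSet_eq_fun hψ.continuous.measurable measurable_const).imp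
      (measurableSet_eq_fun hcont.measurable measurable_const)
  -- By Fubini it is enough to treat almost every point of each line in the direction $e_j$.
  refine ae_mem_of_ae_add_linearMap_mem
    (LinearMap.toSpanSingleton ℝ (Eu d) (EuclideanSpace.single j 1)) volume volume hmeas
    fun y => ?_
  set e : Eu d := EuclideanSpace.single j 1
  have hderiv : ∀ t : ℝ,
      HasDerivAt (fun t : ℝ => ψ (y + t • e)) (partialDeriv j ψ (y + t • e)) t := by
    intro t
    have h1 : HasDerivAt (fun t : ℝ => y + t • e) e t := by
      simpa using ((hasDerivAt_id t).smul_const e).const_add y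
    exact (hdiff (y + t • e)).hasFDerivAt.comp_hasDerivAt t h1
  set T : Set ℝ := {t | ψ (y + t • e) = 0 ∧ partialDeriv j ψ (y + t • e) ≠ 0}
  have hT : T.Countable := by
    -- A zero on the line with nonzero derivative is isolated, so the exceptional set is discrete in
    -- $\mathbb R$, hence countable.
    have : DiscreteTopology T := by
      rw [discreteTopology_subtype_iff]
      intro t ht
      rw [← disjoint_iff, Filter.disjoint_principal_right]
      filter_upwards [(hderiv t).eventually_ne (c := 0) ht.2] with s hs hsT
      exact hs hsT.1
    exact countable_of_Lindelof_of_discrete (X := T)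
  filter_upwards [hT.ae_notMem volume] with t ht h0
  by_contra hne
  exact ht ⟨h0, hne⟩

/-- A smooth truncation of the identity of `ℂ` which vanishes near zero. -/
structure IsTruncation (θ : ℂ → ℂ) (C : ℝ) : Prop where
  contDiff : ContDiff ℝ (⊤ : ℕ∞) θ
  eq_zero : ∀ z, ‖z‖ ≤ 1 → θ z = 0
  eq_self : ∀ z, 2 ≤ ‖z‖ → θ z = z
  norm_fderiv_le : ∀ z, ‖fderiv ℝ θ z‖ ≤ C

/-- $\theta(z)=z-f(z)z$ with a bump function $f$ equal to $1$ on the unit ball and $0$ from radius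
$2$ on. The correction $f(z)z$ has compact support, which bounds the derivative globally. -/
theorem exists_isTruncation : ∃ θ C, IsTruncation θ C := by
  let f : ContDiffBump (0 : ℂ) := ⟨1, 2, one_pos, one_lt_two⟩
  set κ : ℂ → ℂ := fun z => f z • z
  have hκ : ContDiff ℝ (⊤ : ℕ∞) κ := f.contDiff.smul contDiff_id
  have hκs : HasCompactSupport κ := f.hasCompactSupport.smul_right
  obtain ⟨C, hC⟩ := (hκ.continuous_fderiv (by simp)).bounded_above_of_compact_support
    (hκs.fderiv (𝕜 := ℝ))
  refine ⟨fun z => z - κ z, 1 + C, contDiff_id.sub hκ, fun z hz => ?_, fun z hz => ?_, fun z => ?_⟩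
  · have : f z = 1 := f.one_of_mem_closedBall (by simpa [f] using hz)
    simp [κ, this]
  · have : f z = 0 := f.zero_of_le_dist (by simpa [f] using hz)
    simp [κ, this]
  · rw [fderiv_fun_sub differentiableAt_fun_id (hκ.differentiable (by simp) z)]
    refine (norm_sub_le _ _).trans (add_le_add ?_ (hC z))
    rw [fderiv_fun_id]
    exact ContinuousLinearMap.norm_id_le

namespace IsTruncation

variable {θ : ℂ → ℂ} {C : ℝ}

theorem differentiable (h : IsTruncation θ C) : Differentiable ℝ θ :=
  h.contDiff.differentiable (by simp)

theorem norm_le (h : IsTruncation θ C) (z : ℂ) : ‖θ z‖ ≤ C * ‖z‖ := by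
  have := Convex.norm_image_sub_le_of_norm_fderiv_le (𝕜 := ℝ) (s := Set.univ) (x := 0) (y := z)
    (fun x _ => h.differentiable x) (fun x _ => h.norm_fderiv_le x) convex_univ trivial trivial
  rwa [h.eq_zero 0 (by simp), sub_zero, sub_zero] at this

theorem eventually_le_norm_smul {z : ℂ} (hz : z ≠ 0) :
    ∀ᶠ n : ℕ in atTop, 2 < ‖((n : ℝ) + 1) • z‖ := by
  have h1 : Tendsto (fun n : ℕ => ((n : ℝ) + 1) * ‖z‖) atTop atTop :=
    (tendsto_atTop_add_const_right _ 1 tendsto_natCast_atTop_atTop).atTop_mul_const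
      (norm_pos_iff.2 hz)
  filter_upwards [h1.eventually_gt_atTop 2] with n hn
  rwa [norm_smul, Real.norm_of_nonneg (by positivity)]

theorem tendsto_scaled (h : IsTruncation θ C) (z : ℂ) :
    Tendsto (fun n : ℕ => ((n : ℝ) + 1)⁻¹ • θ (((n : ℝ) + 1) • z)) atTop (𝓝 z) := by
  rcases eq_or_ne z 0 with rfl | hz
  · simp [h.eq_zero]
  · refine tendsto_const_nhds.congr' ?_
    filter_upwards [eventually_le_norm_smul hz] with n hn
    rw [h.eq_self _ hn.le, inv_smul_smul₀ (by positivity)]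

theorem fderiv_eq_id (h : IsTruncation θ C) {z : ℂ} (hz : 2 < ‖z‖) :
    fderiv ℝ θ z = ContinuousLinearMap.id ℝ ℂ := by
  have : θ =ᶠ[𝓝 z] fun w => w := by
    filter_upwards [(isOpen_lt continuous_const continuous_norm).mem_nhds hz] with w hw
    exact h.eq_self w (le_of_lt hw)
  rw [this.fderiv_eq, fderiv_fun_id]

/-- At $z=0$ the derivative of $\theta$ is zero, so the limit is right only if $v=0$. For
$v=\partial_j\psi(x)$ and $z=\psi(x)$ this holds almost everywhere by
`ae_partialDeriv_eq_zero_of_eq_zero`. -/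
theorem tendsto_fderiv_scaled (h : IsTruncation θ C) {z v : ℂ} (hv : z = 0 → v = 0) :
    Tendsto (fun n : ℕ => fderiv ℝ θ (((n : ℝ) + 1) • z) v) atTop (𝓝 v) := by
  rcases eq_or_ne z 0 with rfl | hz
  · simp [hv rfl]
  · refine tendsto_const_nhds.congr' ?_
    filter_upwards [eventually_le_norm_smul hz] with n hn
    rw [h.fderiv_eq_id hn]
    rfl

end IsTruncation

/-! ## The space `H¹₀` -/

section H10

variable {d : ℕ} {U V : Opens (Eu d)}

/-- The class in `H¹(U)` of a test function. -/
def testH1 (φ : 𝓓(U, ℂ)) : H1 U := ⟨testL2 φ, fun j => ⟨_, hasWeakPartial_testL2 j φ⟩⟩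

theorem jet_apply (f : H1 U) : jet U f = ((f : L2 U), fun j => weakPartial U j f) := rfl

theorem jet_injective : Function.Injective (jet U) := fun _ _ h =>
  Subtype.ext (congrArg Prod.fst h)

theorem jet_testH1 (φ : 𝓓(U, ℂ)) : jet U (testH1 φ) = (testL2 φ, fun j => testPartialL2 j φ) := by
  rw [jet_apply]
  exact Prod.ext rfl (funext fun j => weakPartial_eq (hasWeakPartial_testL2 j φ))

theorem testL2_eq_iff {φ : 𝓓(U, ℂ)} {f : L2 U} :
    f = testL2 φ ↔ f =ᵐ[volume.restrict (U : Set (Eu d))] φ :=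
  ⟨fun h => h ▸ coeFn_testL2 φ, fun h => Lp.ext (h.trans (coeFn_testL2 φ).symm)⟩

theorem mem_H10_iff {f : H1 U} :
    f ∈ H10 U ↔ jet U f ∈ closure (Set.range fun φ : 𝓓(U, ℂ) => jet U (testH1 φ)) := by
  have h : ((smoothCompact U).map (jet U) : Set (L2 U × (Fin d → L2 U))) =
      Set.range fun φ : 𝓓(U, ℂ) => jet U (testH1 φ) := by
    ext p
    constructor
    · rintro ⟨f, ⟨φ, hφ⟩, rfl⟩
      exact ⟨φ, congrArg _ (Subtype.ext (testL2_eq_iff.2 hφ).symm)⟩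
    · rintro ⟨φ, rfl⟩
      exact ⟨_, ⟨φ, coeFn_testL2 φ⟩, rfl⟩
  rw [H10, Submodule.mem_comap, ← SetLike.mem_coe, Submodule.topologicalClosure_coe, h]

theorem testH1_mem_H10 (φ : 𝓓(U, ℂ)) : testH1 φ ∈ H10 U :=
  mem_H10_iff.2 (subset_closure ⟨φ, rfl⟩)

/-- Each weak identity equates two pairings with fixed $L^2$ functions. Closedness ensures that
limits of jets of test functions are again jets of $H^1$ functions. -/
theorem isClosed_setOf_hasWeakPartial (U : Opens (Eu d)) :
    IsClosed {p : L2 U × (Fin d → L2 U) | ∀ j, HasWeakPartial U j p.1 (p.2 j)} := by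
  simp only [HasWeakPartial, Set.ofPred_forall]
  refine isClosed_iInter fun j => isClosed_iInter fun φ => ?_
  obtain ⟨k, hk⟩ := exists_integral_mul_eq_inner (memLp_partialDeriv j φ)
  obtain ⟨l, hl⟩ := exists_integral_mul_eq_inner (memLp_testFunction φ)
  simp only [hk, hl]
  exact isClosed_eq (by fun_prop) (by fun_prop)

theorem exists_mem_H10_of_mem_closure {p : L2 U × (Fin d → L2 U)}
    (hp : p ∈ closure (Set.range fun φ : 𝓓(U, ℂ) => jet U (testH1 φ))) :
    ∃ f ∈ H10 U, jet U f = p := by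
  have h : p ∈ {p : L2 U × (Fin d → L2 U) | ∀ j, HasWeakPartial U j p.1 (p.2 j)} := by
    refine closure_minimal ?_ (isClosed_setOf_hasWeakPartial U) hp
    rintro _ ⟨φ, rfl⟩ j
    exact weakPartial_spec U j _
  have hj : jet U ⟨p.1, fun j => ⟨_, h j⟩⟩ = p :=
    Prod.ext rfl (funext fun j => weakPartial_eq (h j))
  exact ⟨_, mem_H10_iff.2 (hj.symm ▸ hp :), hj⟩

/-- A continuous map of jets which maps test functions into `H¹₀` maps `H¹₀` into `H¹₀`. -/
theorem exists_mem_H10_of_continuous {J : L2 U × (Fin d → L2 U) → L2 V × (Fin d → L2 V)}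
    (hJ : Continuous J) (h : ∀ φ : 𝓓(U, ℂ), ∃ f ∈ H10 V, jet V f = J (jet U (testH1 φ)))
    {f : H1 U} (hf : f ∈ H10 U) : ∃ f' ∈ H10 V, jet V f' = J (jet U f) := by
  refine exists_mem_H10_of_mem_closure ?_
  rw [← closure_closure]
  refine map_mem_closure hJ (mem_H10_iff.1 hf) ?_
  rintro _ ⟨φ, rfl⟩
  obtain ⟨f, hf, hj⟩ := h φ
  exact hj ▸ mem_H10_iff.1 hf

/-- Continuity of a map `H¹(U) → H¹(V)` with respect to the jet topologies. -/
def JetContinuous (Λ : H1 U →ₗ[ℂ] H1 V) : Prop :=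
  ∃ J : L2 U × (Fin d → L2 U) → L2 V × (Fin d → L2 V),
    Continuous J ∧ ∀ f, jet V (Λ f) = J (jet U f)

theorem JetContinuous.comp {W : Opens (Eu d)} {Λ : H1 U →ₗ[ℂ] H1 V} {Λ' : H1 V →ₗ[ℂ] H1 W}
    (h' : JetContinuous Λ') (h : JetContinuous Λ) : JetContinuous (Λ' ∘ₗ Λ) := by
  obtain ⟨J, hJ, hj⟩ := h
  obtain ⟨J', hJ', hj'⟩ := h'
  exact ⟨J' ∘ J, hJ'.comp hJ, fun f => by simp [hj, hj']⟩

theorem JetContinuous.const_smul {Λ : H1 U →ₗ[ℂ] H1 V} (h : JetContinuous Λ) (a : ℂ) :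
    JetContinuous (a • Λ) := by
  obtain ⟨J, hJ, hj⟩ := h
  exact ⟨fun p => a • J p, hJ.const_smul a, fun f => by simp [hj]⟩

theorem JetContinuous.sum {ι : Type*} [Fintype ι] {Λ : ι → H1 U →ₗ[ℂ] H1 V}
    (h : ∀ i, JetContinuous (Λ i)) : JetContinuous (∑ i, Λ i) := by
  choose J hJ hj using h
  exact ⟨fun p => ∑ i, J i p, continuous_finsetSum _ fun i _ => hJ i, fun f => by simp [hj]⟩

theorem JetContinuous.mem_H10 {Λ : H1 U →ₗ[ℂ] H1 V} (h : JetContinuous Λ)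
    (hφ : ∀ φ : 𝓓(U, ℂ), Λ (testH1 φ) ∈ H10 V) {f : H1 U} (hf : f ∈ H10 U) : Λ f ∈ H10 V := by
  obtain ⟨J, hJ, hj⟩ := h
  obtain ⟨f', hf', h'⟩ := exists_mem_H10_of_continuous hJ (fun φ => ⟨_, hφ φ, hj _⟩) hf
  rw [← hj] at h'
  exact jet_injective h' ▸ hf'

theorem jetContinuous_restrictH1 (h : V ≤ U) : JetContinuous (restrictH1 h) := by
  have hr := continuous_restrictL2 h
  refine ⟨fun p => (restrictL2 h p.1, fun j => restrictL2 h (p.2 j)), ?_, fun f => ?_⟩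
  · exact (hr.comp continuous_fst).prodMk (continuous_pi fun j =>
      hr.comp ((continuous_apply j).comp continuous_snd))
  · rw [jet_apply, jet_apply]
    exact Prod.ext rfl (funext fun j => weakPartial_restrictH1 h j f)

theorem extendL2_eq {f : L2 V} {φ : Eu d → ℂ} {k : L2 U} (h : V ≤ U) (hφ : ∀ x ∉ V, φ x = 0)
    (hf : f =ᵐ[volume.restrict (V : Set (Eu d))] φ)
    (hk : k =ᵐ[volume.restrict (U : Set (Eu d))] φ) : extendL2 h f = k := by
  refine Lp.ext ?_
  filter_upwards [coeFn_extendL2 h f, indicator_ae_eq h hf, hk] with x h1 h2 h3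
  rw [h1, h2, h3]
  by_cases hx : x ∈ (V : Set (Eu d))
  · exact Set.indicator_of_mem hx φ
  · rw [Set.indicator_of_notMem hx, hφ x hx]

/-- Extension by zero maps `H¹₀(V)` into `H¹₀(U)`. -/
theorem exists_mem_H10_extendL2 (h : V ≤ U) {f : H1 V} (hf : f ∈ H10 V) :
    ∃ F ∈ H10 U, (F : L2 U) = extendL2 h f := by
  have hr := continuous_extendL2 h
  obtain ⟨F, hF, hj⟩ := exists_mem_H10_of_continuous
    (J := fun p => (extendL2 h p.1, fun j => extendL2 h (p.2 j)))
    ((hr.comp continuous_fst).prodMk (continuous_pi fun j =>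
      hr.comp ((continuous_apply j).comp continuous_snd)))
    (fun φ => ⟨_, testH1_mem_H10 (testExtend h φ), by
      rw [jet_testH1, jet_testH1]
      refine Prod.ext ?_ (funext fun j => ?_)
      · exact (extendL2_eq h (fun x hx => testFunction_eq_zero φ hx) (coeFn_testL2 φ)
          (coeFn_testL2 (testExtend h φ))).symm
      · exact (extendL2_eq h (fun x hx => partialDeriv_testFunction_eq_zero j φ hx)
          (coeFn_testPartialL2 j φ) (coeFn_testPartialL2 j (testExtend h φ))).symm⟩) hf
  exact ⟨F, hF, congrArg Prod.fst hj⟩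

end H10

namespace NormalizedRootSystem

variable {d : ℕ} {R : NormalizedRootSystem d} {c : Eu d} {Ω : Opens (Eu d)}
  {ω : R.weylGroup → ℂ}

/-! ### Averaging preserves $H^1_0(\Omega)$. -/

theorem jetContinuous_pullbackH1 (hΩ : R.IsSymmetric Ω) (g : R.weylGroup) :
    JetContinuous (pullbackH1 hΩ g) := by
  have hr := continuous_pullback hΩ g
  refine ⟨fun p => (pullback hΩ g p.1, fun j => ∑ i, weylCoeff g j i • pullback hΩ g (p.2 i)),
    ?_, fun f => ?_⟩
  · exact (hr.comp continuous_fst).prodMk (continuous_pi fun j =>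
      continuous_finsetSum _ fun i _ => (continuous_const_smul (weylCoeff g j i)).comp
        (hr.comp ((continuous_apply i).comp continuous_snd)))
  · rw [jet_apply, jet_apply]
    exact Prod.ext rfl (funext fun j => weakPartial_pullbackH1 hΩ g j f)

theorem jetContinuous_averageH1 (hΩ : R.IsSymmetric Ω) (ω : R.weylGroup → ℂ) :
    JetContinuous (averageH1 hΩ ω) :=
  (JetContinuous.sum fun g => (jetContinuous_pullbackH1 hΩ g).const_smul (ω g)).const_smul _

/-- The average of a test function. -/
def testAverage (hΩ : R.IsSymmetric Ω) (ω : R.weylGroup → ℂ) (φ : 𝓓(Ω, ℂ)) : 𝓓(Ω, ℂ) :=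
  (Fintype.card R.weylGroup : ℂ)⁻¹ • ∑ g : R.weylGroup, ω g • testPullback hΩ g φ

theorem testAverage_apply (hΩ : R.IsSymmetric Ω) (ω : R.weylGroup → ℂ) (φ : 𝓓(Ω, ℂ)) (x : Eu d) :
    testAverage hΩ ω φ x =
      (Fintype.card R.weylGroup : ℂ)⁻¹ * ∑ g : R.weylGroup, ω g * φ (g.1 x) := by
  simp [testAverage, coe_testPullback]

theorem averageH1_testH1 (hΩ : R.IsSymmetric Ω) (ω : R.weylGroup → ℂ) (φ : 𝓓(Ω, ℂ)) :
    averageH1 hΩ ω (testH1 φ) = testH1 (testAverage hΩ ω φ) := by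
  refine Subtype.ext ?_
  rw [coe_averageH1, average_apply]
  have h : ∀ g, pullback hΩ g (testL2 φ) = testL2 (testPullback hΩ g φ) := by
    intro g
    rw [testL2_eq_iff]
    exact (coeFn_pullback hΩ g _).trans
      ((hΩ.measurePreserving g).quasiMeasurePreserving.ae_eq_comp (coeFn_testL2 φ))
  let T : 𝓓(Ω, ℂ) →ₗ[ℂ] L2 Ω :=
    { toFun := testL2
      map_add' := fun φ ψ => (testL2_eq_iff.2 (by
        filter_upwards [Lp.coeFn_add (testL2 φ) (testL2 ψ), coeFn_testL2 φ, coeFn_testL2 ψ]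
          with x h1 h2 h3
        rw [h1, Pi.add_apply, h2, h3]
        rfl)).symm
      map_smul' := fun a φ => (testL2_eq_iff.2 (by
        filter_upwards [Lp.coeFn_smul a (testL2 φ), coeFn_testL2 φ] with x h1 h2
        rw [RingHom.id_apply, h1, Pi.smul_apply, h2]
        rfl)).symm }
  have hT : T (testAverage hΩ ω φ) =
      (Fintype.card R.weylGroup : ℂ)⁻¹ • ∑ g : R.weylGroup, ω g • T (testPullback hΩ g φ) := by
    simp only [testAverage, map_smul, map_sum]
  refine Eq.trans ?_ hT.symm
  exact congrArg _ (Finset.sum_congr rfl fun g _ => congrArg _ (h g))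

theorem averageH1_mem_H10 (hΩ : R.IsSymmetric Ω) (ω : R.weylGroup → ℂ) {F : H1 Ω}
    (hF : F ∈ H10 Ω) : averageH1 hΩ ω F ∈ H10 Ω :=
  (jetContinuous_averageH1 hΩ ω).mem_H10
    (fun φ => averageH1_testH1 hΩ ω φ ▸ testH1_mem_H10 _) hF

/-! ## Antisymmetric functions -/

theorem sgn_mul (g h : R.weylGroup) : R.sgn (g * h) = R.sgn g * R.sgn h := by
  rw [sgn, sgn, sgn, ← Complex.ofReal_mul, ← LinearMap.det_comp]
  rfl

theorem sgn_refl {α : Eu d} (hα : α ∈ R.roots) : R.sgn ⟨refl α, refl_mem_weylGroup hα⟩ = -1 := by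
  have hne : α ≠ 0 := fun h => by
    have := R.norm_eq_one α hα
    simp [h] at this
  have h := Submodule.det_reflection (ℝ ∙ α)ᗮ
  rw [Submodule.orthogonal_orthogonal, finrank_span_singleton hne, pow_one] at h
  rw [sgn, h]
  simp

theorem isSignCharacter_sgn (R : NormalizedRootSystem d) : IsSignCharacter R.sgn where
  map_mul := sgn_mul
  conj_eq g := Complex.conj_ofReal _
  mul_self := by
    have h1 : R.sgn 1 = 1 := by
      rw [sgn]
      exact_mod_cast congrArg Complex.ofReal (LinearMap.det_id (A := ℝ) (M := Eu d))
    rintro ⟨g, hg⟩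
    induction hg using Subgroup.closure_induction with
    | mem x hx =>
      obtain ⟨α, hα, rfl⟩ := hx
      rw [sgn_refl hα]
      norm_num
    | one => exact (congrArg₂ _ h1 h1).trans (mul_one _)
    | mul x y hx hy ihx ihy =>
      have := sgn_mul (⟨x, hx⟩ : R.weylGroup) ⟨y, hy⟩
      rw [show (⟨x * y, mul_mem hx hy⟩ : R.weylGroup) = ⟨x, hx⟩ * ⟨y, hy⟩ from rfl, this,
        mul_mul_mul_comm, ihx, ihy, one_mul]
    | inv x hx ih =>
      have h2 : R.sgn (⟨x, hx⟩ : R.weylGroup)⁻¹ * R.sgn ⟨x, hx⟩ = 1 := by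
        rw [← sgn_mul, inv_mul_cancel, h1]
      have h3 : R.sgn (⟨x, hx⟩ : R.weylGroup)⁻¹ = R.sgn ⟨x, hx⟩ := by
        rw [← mul_one (R.sgn _⁻¹), ← ih, ← mul_assoc, h2, one_mul]
      exact (congrArg₂ _ h3 h3).trans ih

theorem testAverage_sgn_refl (hΩ : R.IsSymmetric Ω) (φ : 𝓓(Ω, ℂ)) {α : Eu d} (hα : α ∈ R.roots)
    (x : Eu d) : testAverage hΩ R.sgn φ (refl α x) = -testAverage hΩ R.sgn φ x := by
  rw [testAverage_apply, testAverage_apply, ← mul_neg, ← Finset.sum_neg_distrib]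
  congr 1
  refine Fintype.sum_equiv (Equiv.mulRight ⟨refl α, refl_mem_weylGroup hα⟩) _ _ fun g => ?_
  rw [Equiv.coe_mulRight, sgn_mul, sgn_refl hα, mul_neg_one, neg_mul, neg_neg]
  rfl

/-- A boundary point of $C_+$ lies on a wall $\langle x,\alpha\rangle=0$ and is fixed by
$\sigma_\alpha$, so antisymmetry gives $\psi(x)=-\psi(x)$. -/
theorem eq_zero_of_mem_closure_chamber {ψ : Eu d → ℂ}
    (hψ : ∀ α ∈ R.roots, ∀ x, ψ (refl α x) = -ψ x) {x : Eu d}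
    (hx : x ∈ closure (R.chamber c : Set (Eu d))) (hxc : x ∉ R.chamber c) : ψ x = 0 := by
  have h1 : ∃ α ∈ R.posRoots c, inner ℝ x α ≤ 0 := by
    by_contra! hcon
    exact hxc hcon
  obtain ⟨α, hα, hle⟩ := h1
  have h2 : 0 ≤ inner ℝ x α :=
    closure_minimal (t := {x | 0 ≤ inner ℝ x α}) (fun y hy => (hy α hα).le)
      (isClosed_le continuous_const (by fun_prop)) hx
  have h3 := hψ α hα.1 x
  rw [refl_apply (R.norm_eq_one α hα.1), real_inner_comm, le_antisymm hle h2, mul_zero, zero_smul,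
    sub_zero] at h3
  exact self_eq_neg.1 h3

open Classical in
/-- The truncation near zero of an antisymmetric function on `Ω`, cut off outside the chamber. -/
def truncate (c : Eu d) (R : NormalizedRootSystem d) (θ : ℂ → ℂ) (s : ℝ) (ψ : Eu d → ℂ)
    (x : Eu d) : ℂ :=
  if x ∈ R.chamber c then s⁻¹ • θ (s • ψ x) else 0

theorem truncate_eventuallyEq {θ : ℂ → ℂ} {s : ℝ} {ψ : Eu d → ℂ} {x : Eu d}
    (hx : x ∈ R.chamber c) :
    truncate c R θ s ψ =ᶠ[𝓝 x] fun y => s⁻¹ • θ (s • ψ y) := by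
  filter_upwards [(R.chamber c).isOpen.mem_nhds hx] with y hy
  exact if_pos hy

/-- Near a boundary point of the chamber $|s\psi|<1$, where $\theta$ vanishes. Hence the sharp
cut-off by the chamber creates no singularity and keeps the support inside $C_+$. -/
theorem truncate_eventuallyEq_zero {θ : ℂ → ℂ} {C : ℝ} (hθ : IsTruncation θ C) {s : ℝ}
    {ψ : Eu d → ℂ} (hc : Continuous ψ) (hψ : ∀ α ∈ R.roots, ∀ x, ψ (refl α x) = -ψ x) {x : Eu d}
    (hx : x ∉ R.chamber c) : truncate c R θ s ψ =ᶠ[𝓝 x] fun _ => 0 := by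
  by_cases hcl : x ∈ closure (R.chamber c : Set (Eu d))
  · have h0 := eq_zero_of_mem_closure_chamber hψ hcl hx
    have hlt : ‖s • ψ x‖ < 1 := by simp [h0]
    have hcont : Continuous fun y => ‖s • ψ y‖ := by fun_prop
    filter_upwards [(isOpen_lt hcont continuous_const).mem_nhds hlt] with y hy
    rw [truncate, hθ.eq_zero _ (le_of_lt hy), smul_zero, ite_self]
  · filter_upwards [isClosed_closure.isOpen_compl.mem_nhds hcl] with y hy
    exact if_neg fun h => hy (subset_closure h)

/-- The truncation of an antisymmetric test function on `Ω` is a test function on `Ω_+`. -/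
def testTruncate (c : Eu d) {θ : ℂ → ℂ} {C : ℝ} (hθ : IsTruncation θ C) (s : ℝ) (ψ : 𝓓(Ω, ℂ))
    (hψ : ∀ α ∈ R.roots, ∀ x, ψ (refl α x) = -ψ x) : 𝓓(R.posPart c Ω, ℂ) :=
  have hsupp : tsupport (truncate c R θ s ψ) ⊆ tsupport ψ := by
    refine closure_mono fun x hx h0 => hx ?_
    rw [truncate, h0, smul_zero, hθ.eq_zero 0 (by simp), smul_zero, ite_self]
  ⟨truncate c R θ s ψ, contDiff_iff_contDiffAt.2 fun x => by
      by_cases hx : x ∈ R.chamber c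
      · refine ContDiffAt.congr_of_eventuallyEq ?_ (truncate_eventuallyEq hx)
        exact ((hθ.contDiff.comp (ψ.contDiff.const_smul s)).const_smul s⁻¹).contDiffAt
      · exact contDiffAt_const.congr_of_eventuallyEq
          (truncate_eventuallyEq_zero hθ ψ.continuous hψ hx),
    ψ.hasCompactSupport.of_isClosed_subset (isClosed_tsupport _) hsupp,
    fun x hx => ⟨ψ.tsupport_subset (hsupp hx), by
      by_contra hxc
      exact notMem_tsupport_iff_eventuallyEq.2
        (truncate_eventuallyEq_zero hθ ψ.continuous hψ hxc) hx⟩⟩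

theorem testTruncate_apply {θ : ℂ → ℂ} {C : ℝ} (hθ : IsTruncation θ C) (s : ℝ) (ψ : 𝓓(Ω, ℂ))
    (hψ : ∀ α ∈ R.roots, ∀ x, ψ (refl α x) = -ψ x) {x : Eu d} (hx : x ∈ R.chamber c) :
    testTruncate c hθ s ψ hψ x = s⁻¹ • θ (s • ψ x) :=
  if_pos hx

theorem partialDeriv_testTruncate {θ : ℂ → ℂ} {C : ℝ} (hθ : IsTruncation θ C) {s : ℝ}
    (hs : s ≠ 0) (ψ : 𝓓(Ω, ℂ)) (hψ : ∀ α ∈ R.roots, ∀ x, ψ (refl α x) = -ψ x) (j : Fin d)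
    {x : Eu d} (hx : x ∈ R.chamber c) :
    partialDeriv j (testTruncate c hθ s ψ hψ) x = fderiv ℝ θ (s • ψ x) (partialDeriv j ψ x) := by
  have h1 : HasFDerivAt (fun y => s⁻¹ • θ (s • ψ y))
      (s⁻¹ • (fderiv ℝ θ (s • ψ x)).comp (s • fderiv ℝ ψ x)) x :=
    ((hθ.differentiable _).hasFDerivAt.comp x
      ((differentiable_testFunction ψ x).hasFDerivAt.const_smul s)).const_smul s⁻¹
  have h2 : ⇑(testTruncate c hθ s ψ hψ) =ᶠ[𝓝 x] fun y => s⁻¹ • θ (s • ψ y) :=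
    truncate_eventuallyEq hx
  rw [partialDeriv, h2.fderiv_eq, h1.fderiv]
  simp [partialDeriv, smul_smul, hs]

/-- The truncations $s^{-1}\theta(s\psi)$ with $s=n+1$ are test functions on $\Omega_+$. As
$n\to\infty$ they and their derivatives converge almost everywhere, dominated by $|C\psi|$ and
$|C\,\partial_j\psi|$, so they converge in $H^1(\Omega_+)$. -/
theorem restrictPosH1_testH1_mem_H10 (ψ : 𝓓(Ω, ℂ))
    (hψ : ∀ α ∈ R.roots, ∀ x, ψ (refl α x) = -ψ x) :
    restrictPosH1 c R Ω (testH1 ψ) ∈ H10 (R.posPart c Ω) := by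
  obtain ⟨θ, C, hθ⟩ := exists_isTruncation
  set w : ℕ → 𝓓(R.posPart c Ω, ℂ) := fun n => testTruncate c hθ ((n : ℝ) + 1) ψ hψ with hw
  have hmono := Measure.restrict_mono (μ := (volume : Measure (Eu d)))
    (s := (R.posPart c Ω : Set (Eu d))) (R.posPart_le c Ω) le_rfl
  have hmem : ∀ᵐ x ∂(volume.restrict (R.posPart c Ω : Set (Eu d))), x ∈ R.chamber c := by
    filter_upwards [ae_restrict_mem (R.posPart c Ω).isOpen.measurableSet] with x hx using hx.2
  -- The dominating function enters through its norm, which explains $|C|$.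
  have hC : ∀ z, ‖(C : ℂ) * z‖ = |C| * ‖z‖ := fun z => by simp
  have h0 : Tendsto (fun n => testL2 (w n)) atTop
      (𝓝 (restrictPos c R Ω (testL2 ψ))) := by
    have h := tendsto_toLp_of_dominated (fun n => memLp_testFunction (w n))
      ((memLp_testFunction ψ).mono_measure hmono)
      (((memLp_testFunction ψ).mono_measure hmono).const_mul (C : ℂ)) (fun n => ?_) ?_
    · have he : restrictPos c R Ω (testL2 ψ) =
          ((memLp_testFunction ψ).mono_measure hmono).toLp ψ :=
        Lp.ext ((coeFn_restrictL2 _ _).trans (EventuallyEq.trans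
          (ae_mono hmono (coeFn_testL2 ψ)) (MemLp.coeFn_toLp _).symm))
      rw [he]
      exact h
    · filter_upwards [hmem] with x hx
      rw [hw, testTruncate_apply hθ _ ψ hψ hx, hC, norm_smul, norm_inv,
        Real.norm_of_nonneg (by positivity : (0 : ℝ) ≤ (n : ℝ) + 1)]
      rw [inv_mul_le_iff₀ (by positivity)]
      refine (hθ.norm_le _).trans ?_
      rw [norm_smul, Real.norm_of_nonneg (by positivity : (0 : ℝ) ≤ (n : ℝ) + 1), mul_left_comm]
      gcongr
      exact le_abs_self C
    · filter_upwards [hmem] with x hx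
      refine (hθ.tendsto_scaled (ψ x)).congr fun n => ?_
      rw [hw, testTruncate_apply hθ _ ψ hψ hx]
  have h1 : ∀ j, Tendsto (fun n => testPartialL2 j (w n)) atTop
      (𝓝 (restrictPos c R Ω (testPartialL2 j ψ))) := by
    intro j
    have h := tendsto_toLp_of_dominated (fun n => memLp_partialDeriv j (w n))
      ((memLp_partialDeriv j ψ).mono_measure hmono)
      (((memLp_partialDeriv j ψ).mono_measure hmono).const_mul (C : ℂ)) (fun n => ?_) ?_
    · have he : restrictPos c R Ω (testPartialL2 j ψ) =
          ((memLp_partialDeriv j ψ).mono_measure hmono).toLp (partialDeriv j ψ) :=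
        Lp.ext ((coeFn_restrictL2 _ _).trans (EventuallyEq.trans
          (ae_mono hmono (coeFn_testPartialL2 j ψ)) (MemLp.coeFn_toLp _).symm))
      rw [he]
      exact h
    · filter_upwards [hmem] with x hx
      rw [hw, partialDeriv_testTruncate hθ (by positivity) ψ hψ j hx, hC]
      refine (ContinuousLinearMap.le_opNorm _ _).trans ?_
      gcongr
      exact (hθ.norm_fderiv_le _).trans (le_abs_self C)
    · filter_upwards [hmem, ae_restrict_of_ae (ae_partialDeriv_eq_zero_of_eq_zero
        (ψ.contDiff.of_le (by simp)) j)] with x hx hx0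
      refine (hθ.tendsto_fderiv_scaled hx0).congr fun n => ?_
      rw [hw, partialDeriv_testTruncate hθ (by positivity) ψ hψ j hx]
  rw [mem_H10_iff]
  refine mem_closure_of_tendsto (f := fun n => jet _ (testH1 (w n))) (b := atTop) ?_
    (Eventually.of_forall fun n => ⟨w n, rfl⟩)
  have hlim : jet _ (restrictPosH1 c R Ω (testH1 ψ)) = (restrictPos c R Ω (testL2 ψ),
      fun j => restrictPos c R Ω (testPartialL2 j ψ)) := by
    rw [jet_apply]
    refine Prod.ext rfl (funext fun j => ?_)
    change weakPartial _ j (restrictH1 _ _) = _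
    rw [weakPartial_restrictH1, weakPartial_eq (hasWeakPartial_testL2 j ψ)]
  rw [hlim]
  simp only [jet_testH1]
  exact h0.prodMk_nhds (tendsto_pi_nhds.2 h1)

theorem mem_H10_posPart_iff (hc : ∀ α ∈ R.roots, inner ℝ α c ≠ 0) (hΩ : R.IsSymmetric Ω)
    (f : H1 (R.posPart c Ω)) :
    f ∈ H10 (R.posPart c Ω) ↔
      ∃ F ∈ H10 Ω, averagePos c hΩ R.sgn F = (f : L2 (R.posPart c Ω)) := by
  constructor
  · intro hf
    obtain ⟨F, hF, h⟩ := exists_mem_H10_extendL2 (R.posPart_le c Ω) hf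
    -- The preimage is $|W|$ times the extension by zero, as in `exists_equivariant_extension`.
    refine ⟨(Fintype.card R.weylGroup : ℂ) • F, Submodule.smul_mem _ _ hF, ?_⟩
    rw [Submodule.coe_smul, h]
    exact exists_equivariant_extension hc (isSignCharacter_sgn R) hΩ _
  · rintro ⟨F, hF, h⟩
    have hmem : (restrictPosH1 c R Ω ∘ₗ averageH1 hΩ R.sgn) F ∈ H10 (R.posPart c Ω) := by
      -- Continuity in $H^1$ reduces the claim to test functions, whose averages are antisymmetric
      -- test functions.
      refine ((jetContinuous_restrictH1 _).comp (jetContinuous_averageH1 hΩ R.sgn)).mem_H10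
        (fun φ => ?_) hF
      rw [LinearMap.comp_apply, averageH1_testH1]
      exact restrictPosH1_testH1_mem_H10 _ fun α hα x => testAverage_sgn_refl hΩ φ hα x
    rw [← coe_restrictPosH1_averageH1] at h
    exact Subtype.ext h ▸ hmem

theorem mem_H1eta_iff (hΩ : R.IsSymmetric Ω) (η : R.weylGroup →* ℤˣ) (f : H1 (R.posPart c Ω)) :
    f ∈ H1eta c hΩ η ↔ ∃ F ∈ (⊤ : Submodule ℂ (H1 Ω)),
      averagePos c hΩ (homWeight η) F = (f : L2 (R.posPart c Ω)) := by
  constructor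
  · rintro ⟨F, hF, h⟩
    exact ⟨⟨F, hF⟩, trivial, h⟩
  · rintro ⟨F, -, h⟩
    exact ⟨F, F.2, h⟩

end NormalizedRootSystem

end

end ReflectionLaplacian

theorem proposition4p3 {d : ℕ} (hd : 1 ≤ d) (R : NormalizedRootSystem d)
    (c : EuclideanSpace ℝ (Fin d)) (hc : ∀ α ∈ R.roots, inner ℝ α c ≠ 0)
    (Ω : TopologicalSpace.Opens (EuclideanSpace ℝ (Fin d))) (hΩ : R.IsSymmetric Ω) :
    (∀ η : R.weylGroup →* ℤˣ,
      (etaLaplacian c hΩ η).domain =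
        (neumannLaplacian Ω).domain.map
          (averagePos c hΩ (homWeight η)) ∧
      ∀ F : (neumannLaplacian Ω).domain,
        ∃ h : averagePos c hΩ (homWeight η) F ∈
            (etaLaplacian c hΩ η).domain,
          etaLaplacian c hΩ η ⟨_, h⟩ =
            averagePos c hΩ (homWeight η)
              (neumannLaplacian Ω F)) ∧
    ((dirichletLaplacian (R.posPart c Ω)).domain =
        (dirichletLaplacian Ω).domain.map (averagePos c hΩ R.sgn) ∧
      ∀ F : (dirichletLaplacian Ω).domain,
        ∃ h : averagePos c hΩ R.sgn F ∈
            (dirichletLaplacian (R.posPart c Ω)).domain,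
          dirichletLaplacian (R.posPart c Ω) ⟨_, h⟩ =
            averagePos c hΩ R.sgn (dirichletLaplacian Ω F)) :=
  ⟨fun η => NormalizedRootSystem.formOperator_averagePos hc
    (NormalizedRootSystem.isSignCharacter_homWeight η) hΩ (fun _ _ => trivial)
    (NormalizedRootSystem.mem_H1eta_iff hΩ η)
    fun _ hu => eq_zero_of_inner_testL2_eq_zero fun φ => hu (testH1 φ) trivial,
  NormalizedRootSystem.formOperator_averagePos hc
    (NormalizedRootSystem.isSignCharacter_sgn R) hΩ
    (fun _ hF => NormalizedRootSystem.averageH1_mem_H10 hΩ R.sgn hF)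
    (NormalizedRootSystem.mem_H10_posPart_iff hc hΩ)
    fun _ hu => eq_zero_of_inner_testL2_eq_zero fun φ => hu (testH1 φ) (testH1_mem_H10 φ)⟩
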